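/- Let $2\le M<\infty$. A time series $(X_t)_{t\ge1}$ has law $P$ and $X^{(n)}=(X_1,\dots,X_n)$ is observed. For a benchmark forecasting method (index $0$) and $M$ alternatives, let $\Lambda_m=\Lambda_m(P)\in\mathbb R$ be the risk of method $m$, $\hat\Lambda_{n,m}$ an estimator of it computed from $X^{(n)}$, and put $d_m=\Lambda_0-\Lambda_m$, $\hat d_{n,m}=\hat\Lambda_{n,0}-\hat\Lambda_{n,m}$ for $1\le m\le M$, $d=(d_m)$, $\hat d_n=(\hat d_{n,m})$. The null hypothesis is $d\le 0$ componentwise. Let $\hat\sigma^2_{n,m}$ be functions of $X^{(n)}$, $\hat\sigma_{n,m}=\sqrt{\hat\sigma^2_{n,m}}$, and let $P_n^*$ be the conditional law, given $X^{(n)}$, of a bootstrap replicate $\hat d_n^*\in\mathbb R^M$. For $y\in\mathbb R^M$ write $T^r(y)=\max_m y_m/\hat\sigma_{n,m}$ and $T^s(y)=\min\big(\max_m y_m/\hat\sigma_{n,m},\ \max_m(-y_m/\hat\sigma_{n,m})\big)$. For a significance level $\alpha\in(0,1)$ and a tuning parameter $\gamma\in(0,1)$ let $\hat c^{s*}_n$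 be the $(1-\alpha\gamma)$-quantile of the bootstrap distribution of $T^{s*}=T^s(\sqrt n(\hat d_n^*-\hat d_n))$, and $\hat c^{r*}_n$ the $(1-\alpha(1-\gamma))$-quantile of the bootstrap distribution of $T^{r*}\,1\{T^{s*}\le\hat c^{s*}_n\}$, where $T^{r*}=T^r(\sqrt n(\hat d_n^*-\hat d_n))$; the $p$-quantile of a distribution function $F$ is $\inf\{c: F(c)\ge p\}$. Here the bootstrap distribution is either the exact law $P_n^*$, or the empirical distribution of $B_n$ replicates drawn independently from $P_n^*$ given $X^{(n)}$, with $B_n\to\infty$. The hybrid test is $\phi_n=\phi^r_n(1-\phi^s_n)+\phi^s_n$ with $\phi^r_n=1\{T^r(\sqrt n\hat d_n)>\hat c^{r*}_n\}$ and $\phi^s_n=1\{T^s(\sqrt n\hat d_n)>\hat c^{s*}_n\}$. Basic assumptions on $P$: (a) $\sqrt n(\hat d_n-d)\to N(0,\Sigma)$ in distribution under $P$ for some covariance matrix $\Sigma$, and $\hat\sigma^2_{n,m}\to\Sigma_{m,m}$ in probability for every $m$; (b) $\Sigma_{m,m}>0$ for every $m$; (c) $\sup_{z\in\mathbb R^M}\big|P_n^*\{\sqrt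 n(\hat d_n^*-\hat d_n)\le z\}-P\{\sqrt n(\hat d_n-d)\le z\}\big|\to0$ in probability under $P$. Theorem 1. Let $P$ satisfy the basic assumptions, with $d_m=0$ for some $m$, $d_{m'}<0$ for some $m'$, and $\Sigma$ diagonal. Then for every $\gamma\in(0,1)$ there is $\bar\alpha=\bar\alpha(P,\gamma)\in(0,0.5]$ such that, for every $\alpha\in(0,\bar\alpha)$, the limit $\lim_{n\to\infty}E_P[\phi_n]$ exists and is strictly greater than $\alpha$; $\bar\alpha$ does not depend on the choice of the exact or the simulated bootstrap distribution nor on $(B_n)$. Consequently, if moreover $d\le0$, then for these $\alpha$ the hybrid test is not pointwise asymptotically of level $\alpha$, i.e. it is not true that $\limsup_n E_{P'}[\phi_n]\le\alpha$ for every law $P'$ that satisfies the null hypothesis and the basic assumptions. -/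

import Mathlib

open MeasureTheory ProbabilityTheory Filter Topology

noncomputable section

/-- The sample `X^(n) = (X_1, …, X_n)` extracted from a path of the time series
(`ω i` is the observation with number `i + 1`). -/
def sampleUpTo {X : Type*} (n : ℕ) (ω : ℕ → X) : Fin n → X := fun i => ω i

/-- A forecasting method maps, at each time `n`, the sample `X^(n)` to a forecast. -/
abbrev ForecastMethod (X Y : Type*) : Type _ := (n : ℕ) → (Fin n → X) → Y

/-- The ingredients of a comparison of a benchmark forecasting method (index `0`) with `M`
alternative methods (indices `1, …, M`): the methods, the risk functional, the estimators of the
risks, the estimators of the asymptotic variances and the bootstrap, all of them arbitrary up to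
measurability.  The estimators and the bootstrap are functions of the sample only; the risk may
depend on the unknown law of the series. -/
structure ForecastComparison (M : ℕ) (X Y : Type*) [MeasurableSpace X] where
  /-- the forecasting methods; `0` is the benchmark -/
  method : Fin (M + 1) → ForecastMethod X Y
  /-- the risk of a forecasting method under a law of the time series -/
  risk : ForecastMethod X Y → ProbabilityMeasure (ℕ → X) → ℝ
  /-- the estimators of the risks of the `M + 1` methods -/
  riskEst : (n : ℕ) → (Fin n → X) → Fin (M + 1) → ℝ
  measurable_riskEst : ∀ n, Measurable (riskEst n)
  /-- the estimators `σ̂²_{n,m}` of the asymptotic variances -/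
  varEst : (n : ℕ) → (Fin n → X) → Fin M → ℝ
  measurable_varEst : ∀ n, Measurable (varEst n)
  /-- the conditional law `P*_n`, given the sample, of one bootstrap replicate `d̂*_n` of `d̂_n` -/
  boot : (n : ℕ) → Kernel (Fin n → X) (Fin M → ℝ)
  isMarkovKernel_boot : ∀ n, IsMarkovKernel (boot n)

/-! ### The two statistics, quantiles and critical values -/

/-- `max_m y_m / s_m`. -/
def statR {M : ℕ} (s y : Fin M → ℝ) : ℝ := ⨆ m, y m / s m

/-- `min (max_m y_m / s_m, max_m (- y_m / s_m))`. -/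
def statS {M : ℕ} (s y : Fin M → ℝ) : ℝ := min (⨆ m, y m / s m) (⨆ m, -(y m / s m))

/-- The `p`-quantile `inf {c : p ≤ F c}` of a distribution function `F`. -/
def quantileOf (F : ℝ → ℝ) (p : ℝ) : ℝ := sInf {c : ℝ | p ≤ F c}

/-- The relative frequency with which a tuple of `B` vectors falls in a set. -/
def relFreq {M B : ℕ} (v : Fin B → Fin M → ℝ) (A : Set (Fin M → ℝ)) : ℝ :=
  (1 / (B : ℝ)) * ∑ b, A.indicator (fun _ => (1 : ℝ)) (v b)

/-- The critical value `ĉ^{s*}_n`.  `Q A` is the bootstrap probability that the rescaled centred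
replicate `√n (d̂* - d̂)` is in `A`; `s` is the vector of the `σ̂_{n,m}`. -/
def critS {M : ℕ} (s : Fin M → ℝ) (Q : Set (Fin M → ℝ) → ℝ) (γ α : ℝ) : ℝ :=
  quantileOf (fun c => Q {y | statS s y ≤ c}) (1 - α * γ)

/-- The critical value `ĉ^{r*}_n`, a quantile of `T^{r*} · 1{T^{s*} ≤ ĉ^{s*}_n}`. -/
def critR {M : ℕ} (s : Fin M → ℝ) (Q : Set (Fin M → ℝ) → ℝ) (γ α : ℝ) : ℝ :=
  quantileOf
    (fun c => Q {y | statR s y * {z | statS s z ≤ critS s Q γ α}.indicator (fun _ => 1) y ≤ c})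
    (1 - α * (1 - γ))

/-- The hybrid test `φ^r (1 - φ^s) + φ^s`, where `t` is the vector `√n d̂_n`. -/
def hybrid {M : ℕ} (s t : Fin M → ℝ) (Q : Set (Fin M → ℝ) → ℝ) (γ α : ℝ) : ℝ :=
  let φr : ℝ := (Set.Ioi (critR s Q γ α)).indicator (fun _ => 1) (statR s t)
  let φs : ℝ := (Set.Ioi (critS s Q γ α)).indicator (fun _ => 1) (statS s t)
  φr * (1 - φs) + φs

namespace ForecastComparison

variable {M : ℕ} {X Y : Type*} [MeasurableSpace X] (S : ForecastComparison M X Y)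

/-- `d_m`, the risk of the benchmark minus the risk of the `m`-th alternative. -/
def riskDiff (P : ProbabilityMeasure (ℕ → X)) (m : Fin M) : ℝ :=
  S.risk (S.method 0) P - S.risk (S.method m.succ) P

/-- `d̂_{n,m}`. -/
def dHat (n : ℕ) (x : Fin n → X) (m : Fin M) : ℝ := S.riskEst n x 0 - S.riskEst n x m.succ

/-- `σ̂_{n,m}`. -/
def sigmaHat (n : ℕ) (x : Fin n → X) (m : Fin M) : ℝ := √(S.varEst n x m)

/-- `√n (v - d̂_n)`, the rescaled centred version of a bootstrap replicate `v`. -/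
def centred (n : ℕ) (x : Fin n → X) (v : Fin M → ℝ) : Fin M → ℝ := √(n : ℝ) • (v - S.dHat n x)

/-- The hybrid test whose critical values are computed from `B n` bootstrap replicates, drawn
independently from `P*_n` given the sample: its conditional rejection probability given the
sample. -/
def hybridMC (B : ℕ → ℕ) (γ α : ℝ) (n : ℕ) (x : Fin n → X) : ℝ :=
  ∫ v, hybrid (S.sigmaHat n x) (√(n : ℝ) • S.dHat n x)
      (relFreq fun b : Fin (B n) => S.centred n x (v b)) γ α
    ∂(Measure.pi fun _ : Fin (B n) => S.boot n x)

/-- The hybrid test whose critical values are computed from the exact bootstrap law `P*_n`. -/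
def hybridExact (γ α : ℝ) (n : ℕ) (x : Fin n → X) : ℝ :=
  hybrid (S.sigmaHat n x) (√(n : ℝ) • S.dHat n x)
    (fun A => (S.boot n x).real (S.centred n x ⁻¹' A)) γ α

/-- The standing assumptions on a law `P` of the time series, with asymptotic covariance matrix
`V`: asymptotic normality, consistent variance estimators, positive asymptotic variances and
uniform consistency of the bootstrap. -/
structure Assumptions (P : ProbabilityMeasure (ℕ → X)) (V : Matrix (Fin M) (Fin M) ℝ) :
    Prop where
  posSemidef : V.PosSemidef
  normality : TendstoInDistribution
    (fun (n : ℕ) ω => √(n : ℝ) • (S.dHat n (sampleUpTo n ω) - S.riskDiff P)) atTop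
    (fun z : EuclideanSpace ℝ (Fin M) => (WithLp.ofLp z : Fin M → ℝ))
    (fun _ => (P : Measure (ℕ → X))) (multivariateGaussian 0 V)
  variance_consistent : ∀ m, TendstoInMeasure (P : Measure (ℕ → X))
    (fun n ω => S.varEst n (sampleUpTo n ω) m) atTop (fun _ => V m m)
  variance_pos : ∀ m, 0 < V m m
  bootstrap_consistent : TendstoInMeasure (P : Measure (ℕ → X))
    (fun n ω => ⨆ z : Fin M → ℝ,
      |(S.boot n (sampleUpTo n ω)).real {v | S.centred n (sampleUpTo n ω) v ≤ z} -
        (P : Measure (ℕ → X)).real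
          {ω' | √(n : ℝ) • (S.dHat n (sampleUpTo n ω') - S.riskDiff P) ≤ z}|)
    atTop (fun _ => (0 : ℝ))

/-- The laws that satisfy the null hypothesis `d ≤ 0` and the standing assumptions. -/
def nullLaws : Set (ProbabilityMeasure (ℕ → X)) :=
  {P | S.riskDiff P ≤ 0 ∧ ∃ V, S.Assumptions P V}

end ForecastComparison

/-- The rejection probability `E_P[φ_n]` of a test given through its conditional rejection
probability given the sample. -/
def rejectionProb {X : Type*} [MeasurableSpace X] (φ : (n : ℕ) → (Fin n → X) → ℝ)
    (P : ProbabilityMeasure (ℕ → X)) (n : ℕ) : ℝ :=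
  ∫ ω, φ n (sampleUpTo n ω) ∂(P : Measure (ℕ → X))

/-- A test is pointwise asymptotically of level `α` over a set of laws. -/
def PointwiseAsymptoticLevel {X : Type*} [MeasurableSpace X] (φ : (n : ℕ) → (Fin n → X) → ℝ)
    (P₀ : Set (ProbabilityMeasure (ℕ → X))) (α : ℝ) : Prop :=
  ∀ P ∈ P₀, limsup (rejectionProb φ P) atTop ≤ α

end

/-! The gap comes from an event where the two statistics agree. Suppose first `d ≤ 0`. For an index
with `d_m = 0` the studentized difference stays stochastically bounded, while one with `d_m < 0`
drifts to minus infinity. Hence the drifting coordinates never attain the maximum, and their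
negatives make the second maximum in `statS` irrelevant: with probability tending to one, `statS =
statR`, the maximum over the binding coordinates. If instead some `d_i > 0`, then `statS` itself
diverges and the test rejects with probability tending to one.

The bootstrap is centred, so it does not see the drift. Its limit is a vector of independent
standard normals, because the covariance is diagonal. There `statS > c` with `c ≥ 0` needs two
different coordinates, one above `c` and one below `-c`, so its probability is at most `M² p²`,
where `p` is the normal tail at `c`. At the critical value this probability is `α γ`; if `p ≤ α`,
then `γ ≤ M² α`, which fails for small `α`. So `p > α`: already one binding coordinate exceeds the
critical value of `statS` with limiting probability above `α`. This is `exists_critical_value`.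

The `statR` part of the test does not disturb the limit: since `p > α`, the critical value of
`statR` is eventually at least that of `statS` (`critS_le_critR`), so where the statistics agree the
hybrid test rejects exactly when `statS` does. `hybrid_sandwich` and
`tendsto_measureReal_of_sandwich` turn this into a limit `G c ≥ p > α`. Simulation changes only the
bootstrap probabilities, by a Chebyshev error that vanishes.

Statements "with probability tending to one" are eventualities along the filter `inProb`. It lives
on a sigma type because the space carrying the simulated replicates varies with `n`. -/

noncomputable section

/-! ### Eventually with probability tending to one -/

/-- The filter of the families of events whose probabilities tend to one (in the sense that the
outer measures of the complements tend to zero). -/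
def inProb {W : ℕ → Type*} [∀ n, MeasurableSpace (W n)] (μ : ∀ n, Measure (W n)) :
    Filter (Σ n, W n) where
  sets := {A | Tendsto (fun n => μ n {w | (⟨n, w⟩ : Σ n, W n) ∉ A}) atTop (𝓝 0)}
  univ_sets := by simp
  sets_of_superset := by
    intro A B hA hAB
    refine tendsto_of_tendsto_of_tendsto_of_le_of_le tendsto_const_nhds hA (fun _ => zero_le) ?_
    intro n
    exact measure_mono fun w hw h => hw (hAB h)
  inter_sets := by
    intro A B hA hB
    refine tendsto_of_tendsto_of_tendsto_of_le_of_le tendsto_const_nhds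
      (by simpa using hA.add hB) (fun _ => zero_le) ?_
    intro n
    refine (measure_mono ?_).trans (measure_union_le _ _)
    intro w hw
    by_cases h : (⟨n, w⟩ : Σ n, W n) ∈ A
    · exact Or.inr fun h' => hw ⟨h, h'⟩
    · exact Or.inl h

section InProb

variable {W : ℕ → Type*} [∀ n, MeasurableSpace (W n)] {μ : ∀ n, Measure (W n)}

lemma eventually_inProb_iff {p : (Σ n, W n) → Prop} :
    (∀ᶠ x in inProb μ, p x) ↔
      Tendsto (fun n => μ n {w | ¬ p ⟨n, w⟩}) atTop (𝓝 0) := Iff.rfl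

/-- For large `n` the exceptional event is empty. Ordinary limits in `n` can thus be combined with
limits in probability. -/
lemma tendsto_fst_inProb : Tendsto (Sigma.fst : (Σ n, W n) → ℕ) (inProb μ) atTop := by
  rw [tendsto_atTop]
  intro N
  rw [eventually_inProb_iff]
  refine tendsto_const_nhds.congr' ?_
  filter_upwards [eventually_ge_atTop N] with n hn
  simp [hn]

lemma tendsto_inProb_of_tendstoInMeasure {Ω E : Type*} [MeasurableSpace Ω] [PseudoMetricSpace E]
    {P : Measure Ω} {f : ℕ → Ω → E} {c : E}
    (h : TendstoInMeasure P f atTop (fun _ => c)) :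
    Tendsto (fun x : (Σ _ : ℕ, Ω) => f x.1 x.2) (inProb fun _ => P) (𝓝 c) := by
  rw [Metric.tendsto_nhds]
  intro ε hε
  rw [eventually_inProb_iff]
  have := tendstoInMeasure_iff_dist.1 h ε hε
  simpa [not_lt] using this

lemma tendstoInMeasure_of_tendsto_inProb {Ω E : Type*} [MeasurableSpace Ω] [PseudoMetricSpace E]
    {P : Measure Ω} {f : ℕ → Ω → E} {c : E}
    (h : Tendsto (fun x : (Σ _ : ℕ, Ω) => f x.1 x.2) (inProb fun _ => P) (𝓝 c)) :
    TendstoInMeasure P f atTop (fun _ => c) := by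
  rw [tendstoInMeasure_iff_dist]
  intro ε hε
  have := (Metric.tendsto_nhds.1 h) ε hε
  rw [eventually_inProb_iff] at this
  simpa [not_lt] using this

/-- If the events `F n` are eventually sandwiched between `{c + ε < T n}` and `{c - ε < T n}` with
probability tending to one, for all small `ε`, then their probabilities converge to the limit
of the tail probabilities of `T n` at `c`. -/
lemma tendsto_measureReal_of_sandwich [∀ n, IsProbabilityMeasure (μ n)] {F : ∀ n, Set (W n)}
    {T : ∀ n, W n → ℝ} {G : ℝ → ℝ} {c : ℝ}
    (hG : ∀ c', Tendsto (fun n => (μ n).real {w | c' < T n w}) atTop (𝓝 (G c')))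
    (hGc : ContinuousAt G c)
    (hF : ∀ᶠ ε in 𝓝[>] (0 : ℝ), ∀ᶠ x in inProb μ,
      (c + ε < T x.1 x.2 → x.2 ∈ F x.1) ∧ (x.2 ∈ F x.1 → c - ε < T x.1 x.2)) :
    Tendsto (fun n => (μ n).real (F n)) atTop (𝓝 (G c)) := by
  have h0 : Tendsto (fun ε : ℝ => ε) (𝓝[>] 0) (𝓝 0) := tendsto_id.mono_left nhdsWithin_le_nhds
  have hplus : Tendsto (fun ε => G (c + ε)) (𝓝[>] 0) (𝓝 (G c)) :=
    hGc.tendsto.comp (by simpa using h0.const_add c)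
  have hminus : Tendsto (fun ε => G (c - ε)) (𝓝[>] 0) (𝓝 (G c)) :=
    hGc.tendsto.comp (by simpa using h0.const_sub c)
  rw [tendsto_order]
  constructor
  -- One fixed `ε` suffices: continuity of `G` at `c` chooses it, and the exceptional event, whose
  -- probability vanishes, is the only loss as `n` grows.
  · intro a ha
    obtain ⟨ε, hε, hεF⟩ := ((hplus.eventually (lt_mem_nhds ha)).and hF).exists
    rw [eventually_inProb_iff] at hεF
    have hb := (ENNReal.tendsto_toReal ENNReal.zero_ne_top).comp hεF
    have := (hG (c + ε)).sub hb
    simp only [ENNReal.toReal_zero, sub_zero] at this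
    filter_upwards [this.eventually (lt_mem_nhds hε)] with n hn
    refine hn.trans_le ?_
    rw [sub_le_iff_le_add]
    refine (measureReal_mono ?_).trans (measureReal_union_le _ _)
    intro w hw
    by_cases h : w ∈ F n
    · exact Or.inl h
    · exact Or.inr fun h' => h (h'.1 hw)
  · intro a ha
    obtain ⟨ε, hε, hεF⟩ := ((hminus.eventually (gt_mem_nhds ha)).and hF).exists
    rw [eventually_inProb_iff] at hεF
    have hb := (ENNReal.tendsto_toReal ENNReal.zero_ne_top).comp hεF
    have := (hG (c - ε)).add hb
    simp only [ENNReal.toReal_zero, add_zero] at this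
    filter_upwards [this.eventually (gt_mem_nhds hε)] with n hn
    refine lt_of_le_of_lt ?_ hn
    refine (measureReal_mono ?_).trans (measureReal_union_le _ _)
    intro w hw
    by_cases h : c - ε < T n w
    · exact Or.inl h
    · exact Or.inr fun h' => h (h'.2 hw)

end InProb

/-! ### Finite maxima and the two statistics -/

section Stat

variable {ι : Type*} [Finite ι]

lemma bddAbove_range_of_finite (f : ι → ℝ) : BddAbove (Set.range f) :=
  (Set.finite_range f).bddAbove

lemma continuous_ciSup_of_finite [Nonempty ι] {E : Type*} [TopologicalSpace E] {f : ι → E → ℝ}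
    (hf : ∀ i, Continuous (f i)) : Continuous fun x => ⨆ i, f i x := by
  have := Fintype.ofFinite ι
  have h : (fun x => ⨆ i, f i x) =
      fun x => Finset.univ.sup' Finset.univ_nonempty (fun i => f i x) := by
    ext x
    rw [Finset.sup'_univ_eq_ciSup]
  rw [h]
  exact Continuous.finset_sup'_apply _ fun i _ => hf i

variable {M : ℕ}

/-- Passing to unit scale replaces a statistic with random scale by a fixed continuous function of
the studentized vector, to which weak convergence applies. -/
lemma statR_eq_statR_one (s y : Fin M → ℝ) : statR s y = statR 1 (y / s) := by simp [statR]

lemma statS_eq_statS_one (s y : Fin M → ℝ) : statS s y = statS 1 (y / s) := by simp [statS]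

lemma continuous_statR_one [NeZero M] : Continuous (statR (1 : Fin M → ℝ)) :=
  continuous_ciSup_of_finite fun i => by simpa using continuous_apply i

lemma continuous_statS_one [NeZero M] : Continuous (statS (1 : Fin M → ℝ)) :=
  (continuous_ciSup_of_finite fun i => by simpa using continuous_apply i).min
    (continuous_ciSup_of_finite fun i => by simpa using! (continuous_apply i).neg)

lemma measurable_statR : Measurable fun p : (Fin M → ℝ) × (Fin M → ℝ) => statR p.1 p.2 :=
  Measurable.iSup fun m => by fun_prop

lemma measurable_statS : Measurable fun p : (Fin M → ℝ) × (Fin M → ℝ) => statS p.1 p.2 :=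
  (Measurable.iSup fun m => by fun_prop).min (Measurable.iSup fun m => by fun_prop)

end Stat

/-! ### Quantiles -/

/-- Right-continuity of the distribution function makes the infimum attained. The restriction `0 < p
< 1` makes the set nonempty and bounded below; otherwise the real `sInf` would take its default
value `0`. -/
lemma quantileOf_le_iff {E : Type*} [MeasurableSpace E] {μ : Measure E} [IsProbabilityMeasure μ]
    {T : E → ℝ} (hT : Measurable T) {p : ℝ} (hp : p ∈ Set.Ioo (0 : ℝ) 1) (c : ℝ) :
    quantileOf (fun c => μ.real {y | T y ≤ c}) p ≤ c ↔ p ≤ μ.real {y | T y ≤ c} := by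
  have hprob : IsProbabilityMeasure (μ.map T) := Measure.isProbabilityMeasure_map hT.aemeasurable
  have hF : ∀ c, μ.real {y | T y ≤ c} = cdf (μ.map T) c := by
    intro c
    rw [cdf_eq_real, map_measureReal_apply hT measurableSet_Iic]
    rfl
  simp only [quantileOf, hF]
  set F := cdf (μ.map T)
  have hne : {c | p ≤ F c}.Nonempty :=
    (((tendsto_cdf_atTop (μ.map T)).eventually (lt_mem_nhds hp.2)).mono fun _ h => h.le).exists
  obtain ⟨b, hb⟩ := ((tendsto_cdf_atBot (μ.map T)).eventually (gt_mem_nhds hp.1)).exists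
  have hbdd : BddBelow {c | p ≤ F c} :=
    ⟨b, fun c hc => le_of_not_gt fun h => (lt_of_le_of_lt hc
      ((monotone_cdf (μ.map T) h.le).trans_lt hb)).false⟩
  constructor
  · intro h
    refine le_trans ?_ (monotone_cdf (μ.map T) h)
    refine ge_of_tendsto ((F.right_continuous _).tendsto.mono_left
      (nhdsWithin_mono _ Set.Ioi_subset_Ici_self)) ?_
    filter_upwards [self_mem_nhdsWithin] with x hx
    obtain ⟨c', hc', hlt⟩ := exists_lt_of_csInf_lt hne hx
    exact le_trans hc' (monotone_cdf (μ.map T) hlt.le)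
  · exact fun h => csInf_le hbdd h

lemma hybrid_eq_indicator {M : ℕ} (s t : Fin M → ℝ) (Q : Set (Fin M → ℝ) → ℝ) (γ α : ℝ) :
    hybrid s t Q γ α =
      {t | critR s Q γ α < statR s t ∨ critS s Q γ α < statS s t}.indicator (fun _ => 1) t := by
  by_cases h1 : critR s Q γ α < statR s t <;> by_cases h2 : critS s Q γ α < statS s t <;>
    simp [hybrid, Set.indicator, h1, h2]

/-! ### Comparison of the two critical values -/

section Crit

variable {M : ℕ} {μ : Measure (Fin M → ℝ)} [IsProbabilityMeasure μ] {γ α : ℝ}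

lemma measurable_statR_mul_indicator (c : ℝ) :
    Measurable fun p : (Fin M → ℝ) × (Fin M → ℝ) =>
      statR p.1 p.2 * {z | statS p.1 z ≤ c}.indicator (fun _ => (1 : ℝ)) p.2 := by
  have : (fun p : (Fin M → ℝ) × (Fin M → ℝ) =>
      statR p.1 p.2 * {z | statS p.1 z ≤ c}.indicator (fun _ => (1 : ℝ)) p.2) =
      fun p => statR p.1 p.2 *
        {q : (Fin M → ℝ) × (Fin M → ℝ) | statS q.1 q.2 ≤ c}.indicator (fun _ => (1 : ℝ)) p := by
    ext p
    simp [Set.indicator]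
  rw [this]
  exact measurable_statR.mul (measurable_const.indicator
    (measurableSet_le measurable_statS measurable_const))

lemma one_sub_mul_mem_Ioo (hα : α ∈ Set.Ioo (0 : ℝ) 1) (hγ : γ ∈ Set.Ioo (0 : ℝ) 1) :
    1 - α * γ ∈ Set.Ioo (0 : ℝ) 1 := by
  have := mul_pos hα.1 hγ.1
  have := mul_lt_one_of_nonneg_of_lt_one_left hα.1.le hα.2 hγ.2.le
  constructor <;> linarith

lemma one_sub_mem_Ioo (hγ : γ ∈ Set.Ioo (0 : ℝ) 1) : 1 - γ ∈ Set.Ioo (0 : ℝ) 1 :=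
  ⟨by linarith [hγ.2], by linarith [hγ.1]⟩

variable (hα : α ∈ Set.Ioo (0 : ℝ) 1) (hγ : γ ∈ Set.Ioo (0 : ℝ) 1) (s : Fin M → ℝ)

include hα hγ in
lemma critS_le_iff (c : ℝ) :
    critS s μ.real γ α ≤ c ↔ 1 - α * γ ≤ μ.real {y | statS s y ≤ c} :=
  quantileOf_le_iff (measurable_statS.comp (measurable_const.prodMk measurable_id))
    (one_sub_mul_mem_Ioo hα hγ) c

include hα hγ in
lemma critR_le_iff (c : ℝ) :
    critR s μ.real γ α ≤ c ↔ 1 - α * (1 - γ) ≤ μ.real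
      {y | statR s y * {z | statS s z ≤ critS s μ.real γ α}.indicator (fun _ => 1) y ≤ c} :=
  quantileOf_le_iff
    ((measurable_statR_mul_indicator _).comp (measurable_const.prodMk measurable_id))
    (one_sub_mul_mem_Ioo hα (one_sub_mem_Ioo hγ)) c

include hα hγ in
/-- If the bootstrap probability that `statR` exceeds the critical value of `statS` is larger than
`α`, then that critical value is at most the critical value of `statR`. -/
lemma critS_le_critR
    (hR : μ.real {y | statR s y ≤ critS s μ.real γ α} < 1 - α) :
    critS s μ.real γ α ≤ critR s μ.real γ α := by
  by_contra! hlt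
  have h1 := (critR_le_iff (μ := μ) hα hγ s _).1 hlt.le
  have h2 := (critS_le_iff (μ := μ) hα hγ s _).1 le_rfl
  set c := critS s μ.real γ α
  have hmeas : MeasurableSet {y | statS s y ≤ c} :=
    (measurable_statS.comp (measurable_const.prodMk measurable_id)) measurableSet_Iic
  have h3 : μ.real {y | statS s y ≤ c}ᶜ = 1 - μ.real {y | statS s y ≤ c} :=
    probReal_compl_eq_one_sub hmeas
  -- The truncation is inactive where `statS ≤ c`, and the complement has mass at most `α γ`. So `1
  -- - α (1 - γ)` is at most the mass of `statR ≤ c` plus `α γ`, which contradicts `hR`.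
  have h4 : μ.real {y | statR s y * {z | statS s z ≤ c}.indicator (fun _ => 1) y ≤ c} ≤
      μ.real {y | statR s y ≤ c} + μ.real {y | statS s y ≤ c}ᶜ := by
    refine (measureReal_mono ?_).trans (measureReal_union_le _ _)
    intro y hy
    by_cases h : statS s y ≤ c
    · left
      simpa [h] using hy
    · exact Or.inr h
  linarith

include hα hγ in
/-- Sandwich for the rejection region of the hybrid test. -/
lemma hybrid_sandwich {c ε : ℝ} (hε : 0 < ε)
    (h1 : μ.real {y | statS s y ≤ c - ε} < 1 - α * γ)
    (h2 : 1 - α * γ < μ.real {y | statS s y ≤ c + ε})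
    (h3 : μ.real {y | statR s y ≤ c + ε} < 1 - α) {t : Fin M → ℝ}
    (ht : statS s t = statR s t ∨ c + 1 < statS s t) :
    (c + ε < statS s t → critR s μ.real γ α < statR s t ∨ critS s μ.real γ α < statS s t) ∧
    ((critR s μ.real γ α < statR s t ∨ critS s μ.real γ α < statS s t) → c - ε < statS s t) := by
  have hle : critS s μ.real γ α ≤ c + ε := (critS_le_iff hα hγ s _).2 h2.le
  have hlt : c - ε < critS s μ.real γ α := by
    by_contra! h
    exact absurd ((critS_le_iff hα hγ s _).1 h) (not_le.2 h1)
  have hle' : critS s μ.real γ α ≤ critR s μ.real γ α := by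
    refine critS_le_critR hα hγ s (lt_of_le_of_lt (measureReal_mono ?_) h3)
    exact fun y hy => le_trans hy hle
  refine ⟨fun h => Or.inr (hle.trans_lt h), ?_⟩
  -- If the statistics agree, exceeding either critical value puts `statS` above `critS`, hence
  -- above `c - ε`. In the other case `statS` is already beyond `c + 1`, where any fixed margin
  -- would do.
  rcases ht with ht | ht
  · rintro (h | h)
    · rw [ht]; linarith
    · linarith
  · intro _; linarith

end Crit

/-- The rejection region of the hybrid test as an event. -/
def rejectionEvent {M : ℕ} {W : Type*} (K : W → Measure (Fin M → ℝ)) (s t : W → Fin M → ℝ)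
    (γ α : ℝ) : Set W :=
  {w | critR (s w) (K w).real γ α < statR (s w) (t w) ∨
    critS (s w) (K w).real γ α < statS (s w) (t w)}

lemma hybrid_eq_indicator_rejectionEvent {M : ℕ} {W : Type*}
    (K : W → Measure (Fin M → ℝ)) (s t : W → Fin M → ℝ) (γ α : ℝ)
    (w : W) : hybrid (s w) (t w) (K w).real γ α =
      (rejectionEvent K s t γ α).indicator (fun _ => 1) w := by
  rw [hybrid_eq_indicator]
  simp only [Set.indicator, rejectionEvent, Set.mem_ofPred_eq]
  congr

/-! ### Measurability of the critical values and of the rejection region -/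

section Measurability

variable {M : ℕ} {W : Type*} [MeasurableSpace W] {K : W → Measure (Fin M → ℝ)}
  [∀ w, IsProbabilityMeasure (K w)] {γ α : ℝ}

lemma measurable_measureReal_section {E : Type*} [MeasurableSpace E] {K : W → Measure E}
    [∀ w, IsProbabilityMeasure (K w)] (hK : Measurable K) {A : W → Set E}
    (hA : MeasurableSet {p : W × E | p.2 ∈ A p.1}) : Measurable fun w => (K w).real (A w) := by
  let κ : Kernel W E := ⟨K, hK⟩
  have : IsMarkovKernel κ := ⟨fun w => inferInstanceAs (IsProbabilityMeasure (K w))⟩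
  exact (Kernel.measurable_kernel_prodMk_left (κ := κ) hA).ennreal_toReal

variable (hα : α ∈ Set.Ioo (0 : ℝ) 1) (hγ : γ ∈ Set.Ioo (0 : ℝ) 1) (hK : Measurable K)
  {s t : W → Fin M → ℝ} (hs : Measurable s) (ht : Measurable t)

include hα hγ hK hs in
-- The quantile equivalence turns sublevel sets of the critical value into conditions on kernel
-- probabilities of sections, so the infimum over uncountably many `c` causes no trouble.
lemma measurable_critS : Measurable fun w => critS (s w) (K w).real γ α := by
  refine measurable_of_Iic fun c => ?_
  have : (fun w => critS (s w) (K w).real γ α) ⁻¹' Set.Iic c =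
      {w | 1 - α * γ ≤ (K w).real {y | statS (s w) y ≤ c}} := by
    ext w
    exact critS_le_iff hα hγ (s w) c
  rw [this]
  exact measurableSet_le measurable_const (measurable_measureReal_section hK
    (measurableSet_le (measurable_statS.comp ((hs.comp measurable_fst).prodMk measurable_snd))
      measurable_const))

include hα hγ hK hs in
lemma measurable_critR : Measurable fun w => critR (s w) (K w).real γ α := by
  refine measurable_of_Iic fun c => ?_
  have : (fun w => critR (s w) (K w).real γ α) ⁻¹' Set.Iic c =
      {w | 1 - α * (1 - γ) ≤ (K w).real {y | statR (s w) y *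
        {z | statS (s w) z ≤ critS (s w) (K w).real γ α}.indicator (fun _ => 1) y ≤ c}} := by
    ext w
    exact critR_le_iff hα hγ (s w) c
  rw [this]
  refine measurableSet_le measurable_const (measurable_measureReal_section hK ?_)
  have hsy : Measurable fun p : W × (Fin M → ℝ) => (s p.1, p.2) :=
    (hs.comp measurable_fst).prodMk measurable_snd
  have hset : MeasurableSet {p : W × (Fin M → ℝ) |
      statS (s p.1) p.2 ≤ critS (s p.1) (K p.1).real γ α} :=
    measurableSet_le (measurable_statS.comp hsy)
      ((measurable_critS hα hγ hK hs).comp measurable_fst)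
  have h := (measurable_statR.comp hsy).mul ((measurable_const (a := (1 : ℝ))).indicator hset)
  refine measurableSet_le (f := fun p : W × (Fin M → ℝ) => statR (s p.1) p.2 *
    {z | statS (s p.1) z ≤ critS (s p.1) (K p.1).real γ α}.indicator (fun _ => 1) p.2) ?_
    measurable_const
  convert h using 1
  ext p
  simp [Set.indicator]

include hα hγ hK hs ht in
lemma measurableSet_rejectionEvent : MeasurableSet (rejectionEvent K s t γ α) :=
  (measurableSet_lt (measurable_critR hα hγ hK hs) (measurable_statR.comp (hs.prodMk ht))).union
    (measurableSet_lt (measurable_critS hα hγ hK hs) (measurable_statS.comp (hs.prodMk ht)))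

end Measurability


/-! ### Weak convergence from convergence of multivariate distribution functions -/

section WeakConvergence

variable {I : Type*} [Fintype I] {ι : Type*} {l : Filter ι}

/-- Inclusion–exclusion, one lower constraint at a time: the constraint at `k` is imposed by
subtracting the set whose upper bound at `k` is lowered to `a k`. The bound `b` therefore has to
vary in the induction. -/
lemma tendsto_measureReal_of_tendsto_Iic {μ : ι → ProbabilityMeasure (I → ℝ)}
    {ν : ProbabilityMeasure (I → ℝ)}
    (h : ∀ z, Tendsto (fun i => (μ i : Measure (I → ℝ)).real (Set.Iic z)) l
      (𝓝 ((ν : Measure (I → ℝ)).real (Set.Iic z)))) (a : I → ℝ) (J : Finset I) :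
    ∀ b : I → ℝ, Tendsto (fun i => (μ i : Measure (I → ℝ)).real {y | y ≤ b ∧ ∀ m ∈ J, a m < y m}) l
      (𝓝 ((ν : Measure (I → ℝ)).real {y | y ≤ b ∧ ∀ m ∈ J, a m < y m})) := by
  classical
  induction J using Finset.induction_on with
  | empty => intro b; simpa [Set.Iic] using h b
  | insert k J hk ih =>
    intro b
    have key : ∀ ρ : Measure (I → ℝ), IsProbabilityMeasure ρ →
        ρ.real {y | y ≤ b ∧ ∀ m ∈ insert k J, a m < y m} =
        ρ.real {y | y ≤ b ∧ ∀ m ∈ J, a m < y m} -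
        -- The minimum covers `b k < a k`, where the constrained set is empty and both terms
        -- coincide.
        ρ.real {y | y ≤ Function.update b k (min (a k) (b k)) ∧ ∀ m ∈ J, a m < y m} := by
      intro ρ hρ
      have hsub : {y | y ≤ Function.update b k (min (a k) (b k)) ∧ ∀ m ∈ J, a m < y m} ⊆
          {y | y ≤ b ∧ ∀ m ∈ J, a m < y m} := by
        rintro y ⟨hy, hy'⟩
        refine ⟨hy.trans ?_, hy'⟩
        intro m
        by_cases hm : m = k
        · subst hm; simp
        · simp [hm]
      have hmeas : MeasurableSet
          {y | y ≤ Function.update b k (min (a k) (b k)) ∧ ∀ m ∈ J, a m < y m} := by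
        refine MeasurableSet.inter measurableSet_Iic ?_
        have : {y : I → ℝ | ∀ m ∈ J, a m < y m} = ⋂ m ∈ J, {y | a m < y m} := by ext; simp
        change MeasurableSet {y : I → ℝ | ∀ m ∈ J, a m < y m}
        rw [this]
        refine Finset.measurableSet_biInter _ fun m _ => ?_
        exact measurableSet_lt measurable_const (measurable_pi_apply m)
      rw [← measureReal_sdiff hsub hmeas]
      congr 1
      ext y
      simp only [Set.mem_ofPred_eq, Finset.forall_mem_insert, Set.mem_sdiff]
      constructor
      · rintro ⟨h1, h2, h3⟩
        refine ⟨⟨h1, h3⟩, fun h4 => ?_⟩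
        have := h4.1 k
        simp only [Function.update_self, le_min_iff] at this
        linarith
      · rintro ⟨⟨h1, h3⟩, h4⟩
        refine ⟨h1, ?_, h3⟩
        by_contra! h5
        refine h4 ⟨fun m => ?_, h3⟩
        by_cases hm : m = k
        · subst hm; simpa using ⟨h5, h1 m⟩
        · simpa [hm] using h1 m
    rw [key _ inferInstance]
    simp_rw [fun i => key (μ i : Measure (I → ℝ)) inferInstance]
    exact (ih b).sub (ih _)

/-- Pointwise convergence of the distribution functions implies weak convergence. -/
lemma tendsto_probabilityMeasure_of_tendsto_Iic [l.IsCountablyGenerated]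
    {μ : ι → ProbabilityMeasure (I → ℝ)} {ν : ProbabilityMeasure (I → ℝ)}
    (h : ∀ z, Tendsto (fun i => (μ i : Measure (I → ℝ)).real (Set.Iic z)) l
      (𝓝 ((ν : Measure (I → ℝ)).real (Set.Iic z)))) : Tendsto μ l (𝓝 ν) := by
  have hbox : ∀ a b : I → ℝ, (Set.univ.pi fun m => Set.Ioc (a m) (b m)) =
      {y | y ≤ b ∧ ∀ m ∈ (Finset.univ : Finset I), a m < y m} := by
    intro a b
    ext y
    simp only [Set.mem_pi, Set.mem_univ, true_implies, Set.mem_Ioc, Set.mem_ofPred_eq,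
      Finset.mem_univ, Pi.le_def]
    exact ⟨fun hy => ⟨fun m => (hy m).2, fun m => (hy m).1⟩, fun hy m => ⟨hy.2 m, hy.1 m⟩⟩
  -- Half-open boxes form a π-system, every neighbourhood of a point contains one that is itself a
  -- neighbourhood, and their probabilities converge by the preceding lemma.
  refine IsPiSystem.tendsto_probabilityMeasure_of_tendsto_of_mem
    (S := Set.range fun p : (I → ℝ) × (I → ℝ) => Set.univ.pi fun m => Set.Ioc (p.1 m) (p.2 m))
    ?_ ?_ ?_ ?_
  · rintro _ ⟨p, rfl⟩ _ ⟨q, rfl⟩ -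
    refine ⟨(p.1 ⊔ q.1, p.2 ⊓ q.2), ?_⟩
    simp only [← Set.pi_inter_distrib, Set.Ioc_inter_Ioc]
    rfl
  · rintro _ ⟨p, rfl⟩
    exact MeasurableSet.univ_pi fun m => measurableSet_Ioc
  · intro u hu x hx
    obtain ⟨ε, hε, hεu⟩ := Metric.isOpen_iff.1 hu x hx
    refine ⟨_, ⟨(fun m => x m - ε / 2, fun m => x m + ε / 2), rfl⟩, ?_, ?_⟩
    · refine set_pi_mem_nhds Set.finite_univ fun m _ => ?_
      exact Ioc_mem_nhds (by linarith) (by linarith)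
    · intro y hy
      refine hεu ?_
      rw [Metric.mem_ball, dist_pi_lt_iff hε]
      intro m
      have := hy m (Set.mem_univ m)
      simp only [Set.mem_Ioc] at this
      rw [Real.dist_eq, abs_lt]
      constructor <;> linarith
  · rintro _ ⟨p, rfl⟩
    have := tendsto_measureReal_of_tendsto_Iic h p.1 Finset.univ p.2
    rw [← hbox] at this
    rw [← NNReal.tendsto_coe]
    exact this

/-- Weak convergence implies convergence of the distribution function of a continuous statistic
at the points that are not atoms of its limit law. -/
lemma tendsto_measureReal_le_of_tendsto {E : Type*} [MeasurableSpace E] [TopologicalSpace E]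
    [OpensMeasurableSpace E] [HasOuterApproxClosed E] {μ : ι → ProbabilityMeasure E}
    {ν : ProbabilityMeasure E} (h : Tendsto μ l (𝓝 ν)) {T : E → ℝ} (hT : Continuous T) {c : ℝ}
    (hc : (ν : Measure E) {y | T y = c} = 0) :
    Tendsto (fun i => (μ i : Measure E).real {y | T y ≤ c}) l
      (𝓝 ((ν : Measure E).real {y | T y ≤ c})) := by
  refine (ENNReal.tendsto_toReal (by finiteness)).comp
    (ProbabilityMeasure.tendsto_measure_of_null_frontier_of_tendsto' h ?_)
  exact measure_mono_null (frontier_le_subset_eq hT continuous_const) hc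

end WeakConvergence

/-! ### The standard normal vector -/

/-- The law of a vector of `M` independent standard normal variables. -/
def stdNormal (M : ℕ) : Measure (Fin M → ℝ) := Measure.pi fun _ => gaussianReal 0 1

section StdNormal

variable {M : ℕ}

instance : IsProbabilityMeasure (stdNormal M) :=
  inferInstanceAs (IsProbabilityMeasure (Measure.pi _))

instance : (stdNormal M).IsOpenPosMeasure := by
  have : (gaussianReal 0 1).IsOpenPosMeasure :=
    (gaussianReal_absolutelyContinuous' 0 one_ne_zero).isOpenPosMeasure
  exact inferInstanceAs (Measure.pi _).IsOpenPosMeasure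

lemma measurePreserving_eval_stdNormal (m : Fin M) :
    MeasurePreserving (Function.eval m) (stdNormal M) (gaussianReal 0 1) :=
  measurePreserving_eval _ m

lemma stdNormal_eval_mem_singleton (m : Fin M) (c : ℝ) : stdNormal M {y | y m = c} = 0 := by
  have := nullSingletonClass_gaussianReal (μ := 0) (one_ne_zero (α := NNReal))
  have h := (measurePreserving_eval_stdNormal m).measure_preimage
    (measurableSet_singleton c).nullMeasurableSet
  rw [measure_singleton] at h
  exact h

/-- A finite maximum or minimum of the `y m` and `-y m` is attained, so its level sets lie in
finitely many null hyperplanes. -/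
lemma stdNormal_null_of_subset {A : Set (Fin M → ℝ)} {c : ℝ}
    (h : ∀ y ∈ A, ∃ m, y m = c ∨ y m = -c) : stdNormal M A = 0 := by
  refine measure_mono_null (t := ⋃ m, ({y | y m = c} ∪ {y | y m = -c})) ?_ ?_
  · intro y hy
    simpa using h y hy
  · exact measure_iUnion_null fun m => measure_union_null (stdNormal_eval_mem_singleton m c)
      (stdNormal_eval_mem_singleton m _)

lemma stdNormal_ciSup_eq {ι : Type*} [Finite ι] [Nonempty ι] (f : ι → Fin M) (c : ℝ) :
    stdNormal M {y | ⨆ i, y (f i) = c} = 0 := by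
  refine stdNormal_null_of_subset (c := c) fun y hy => ?_
  obtain ⟨i, hi⟩ := exists_eq_ciSup_of_finite (f := fun i => y (f i))
  exact ⟨f i, Or.inl (hi.trans hy)⟩

lemma stdNormal_statR_eq [NeZero M] (c : ℝ) : stdNormal M {y | statR 1 y = c} = 0 := by
  simpa [statR] using stdNormal_ciSup_eq (id : Fin M → Fin M) c

lemma stdNormal_statS_eq [NeZero M] (c : ℝ) : stdNormal M {y | statS 1 y = c} = 0 := by
  refine stdNormal_null_of_subset (c := c) fun y hy => ?_
  simp only [statS, Pi.one_apply, div_one, Set.mem_ofPred_eq] at hy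
  rcases min_choice (⨆ m, y m) (⨆ m, -(y m)) with h | h
  · obtain ⟨i, hi⟩ := exists_eq_ciSup_of_finite (f := fun i => y i)
    exact ⟨i, Or.inl (by rw [hi, ← h, hy])⟩
  · obtain ⟨i, hi⟩ := exists_eq_ciSup_of_finite (f := fun i => -(y i))
    exact ⟨i, Or.inr (by rw [← hy, h, ← hi, neg_neg])⟩

/-- The distribution function of a continuous statistic without atoms is continuous. -/
lemma continuous_measureReal_le {E : Type*} [MeasurableSpace E] {μ : Measure E}
    [IsProbabilityMeasure μ] {T : E → ℝ} (hT : Measurable T) (h : ∀ c, μ {y | T y = c} = 0) :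
    Continuous fun c => μ.real {y | T y ≤ c} := by
  have hprob : IsProbabilityMeasure (μ.map T) := Measure.isProbabilityMeasure_map hT.aemeasurable
  have hF : (fun c => μ.real {y | T y ≤ c}) = cdf (μ.map T) := by
    ext c
    rw [cdf_eq_real, map_measureReal_apply hT measurableSet_Iic]
    rfl
  rw [hF, continuous_iff_continuousAt]
  intro c
  have hs : (cdf (μ.map T)).measure {c} = 0 := by
    rw [measure_cdf, Measure.map_apply hT (measurableSet_singleton c)]
    exact h c
  rw [StieltjesFunction.measure_singleton, ENNReal.ofReal_eq_zero, sub_nonpos] at hs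
  rw [(monotone_cdf _).continuousAt_iff_leftLim_eq_rightLim, StieltjesFunction.rightLim_eq]
  exact le_antisymm ((monotone_cdf _).leftLim_le le_rfl) hs

/-- Positive values need one coordinate at `c` and another at `-c`; with a single coordinate `statS`
would be `-|y|`. This is where `2 ≤ M` matters. -/
lemma exists_statS_one_eq (hM : 2 ≤ M) (c : ℝ) : ∃ y : Fin M → ℝ, statS 1 y = c := by
  have : NeZero M := ⟨by omega⟩
  rcases le_total 0 c with hc | hc
  · refine ⟨fun m => if m = ⟨0, by omega⟩ then c else -c, ?_⟩
    simp only [statS, Pi.one_apply, div_one]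
    have h1 : ⨆ m : Fin M, (if m = ⟨0, by omega⟩ then c else -c) = c := by
      refine le_antisymm (ciSup_le fun m => ?_) ?_
      · split_ifs <;> linarith
      · exact (le_of_eq (by simp)).trans
          (le_ciSup (bddAbove_range_of_finite _) (⟨0, by omega⟩ : Fin M))
    have h2 : ⨆ m : Fin M, -(if m = ⟨0, by omega⟩ then c else -c) = c := by
      refine le_antisymm (ciSup_le fun m => ?_) ?_
      · split_ifs <;> linarith
      · refine le_trans (le_of_eq ?_)
          (le_ciSup (bddAbove_range_of_finite _) (⟨1, by omega⟩ : Fin M))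
        rw [if_neg (by simp), neg_neg]
    rw [h1, h2, min_self]
  · refine ⟨fun _ => c, ?_⟩
    simp only [statS, Pi.one_apply, div_one, ciSup_const]
    exact min_eq_left (by linarith)

/-- The preimage of an open interval is open, and nonempty by surjectivity, so the normal law
charges it. -/
lemma strictMono_stdNormal_statS (hM : 2 ≤ M) :
    StrictMono fun c => (stdNormal M).real {y | statS 1 y ≤ c} := by
  have : NeZero M := ⟨by omega⟩
  intro a b hab
  have hopen : IsOpen {y : Fin M → ℝ | a < statS 1 y ∧ statS 1 y < b} :=
    (isOpen_lt continuous_const continuous_statS_one).inter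
      (isOpen_lt continuous_statS_one continuous_const)
  obtain ⟨c, hc⟩ := exists_between hab
  obtain ⟨y, hy⟩ := exists_statS_one_eq hM c
  have hpos : 0 < (stdNormal M).real {y : Fin M → ℝ | a < statS 1 y ∧ statS 1 y < b} :=
    ENNReal.toReal_pos (hopen.measure_pos _ ⟨y, by simpa [hy] using hc⟩).ne' (by finiteness)
  have hdisj : Disjoint {y : Fin M → ℝ | statS 1 y ≤ a}
      {y : Fin M → ℝ | a < statS 1 y ∧ statS 1 y < b} :=
    Set.disjoint_left.2 fun y hy hy' => (not_lt.2 hy) hy'.1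
  have hle := measureReal_mono (μ := stdNormal M)
    (s₁ := {y : Fin M → ℝ | statS 1 y ≤ a} ∪ {y : Fin M → ℝ | a < statS 1 y ∧ statS 1 y < b})
    (s₂ := {y : Fin M → ℝ | statS 1 y ≤ b}) (by
      rintro y (h | h)
      · exact le_trans h hab.le
      · exact h.2.le)
  rw [measureReal_union hdisj hopen.measurableSet] at hle
  simp only
  linarith

lemma stdNormal_lt_eval (m : Fin M) (c : ℝ) :
    (stdNormal M).real {y | c < y m} = (gaussianReal 0 1).real (Set.Ioi c) := by
  have := (measurePreserving_eval_stdNormal m).measure_preimage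
    (measurableSet_Ioi (a := c)).nullMeasurableSet
  rw [measureReal_def, measureReal_def, ← this]
  rfl

lemma stdNormal_eval_lt_neg (m : Fin M) (c : ℝ) :
    (stdNormal M).real {y | y m < -c} = (gaussianReal 0 1).real (Set.Ioi c) := by
  have h1 := (measurePreserving_eval_stdNormal m).measure_preimage
    (measurableSet_Iio (a := -c)).nullMeasurableSet
  have h2 : (gaussianReal 0 1).map (fun x => -x) (Set.Ioi c) = gaussianReal 0 1 (Set.Iio (-c)) := by
    rw [Measure.map_apply measurable_neg measurableSet_Ioi]
    congr 1
    ext x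
    simp
  rw [gaussianReal_map_neg, neg_zero] at h2
  rw [measureReal_def, measureReal_def, h2, ← h1]
  rfl

lemma stdNormal_lt_and_lt {i j : Fin M} (hij : i ≠ j) (c : ℝ) :
    (stdNormal M).real ({y | c < y i} ∩ {y | y j < -c}) =
      (gaussianReal 0 1).real (Set.Ioi c) ^ 2 := by
  have hind : iIndepFun (fun (m : Fin M) (y : Fin M → ℝ) => y m) (stdNormal M) :=
    iIndepFun_pi (X := fun _ => id) fun _ => aemeasurable_id
  have := (hind.indepFun hij).measure_inter_preimage_eq_mul (Set.Ioi c) (Set.Iio (-c))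
    measurableSet_Ioi measurableSet_Iio
  rw [sq]
  nth_rewrite 1 [← stdNormal_lt_eval i c]
  rw [← stdNormal_eval_lt_neg j c, measureReal_def, measureReal_def, measureReal_def,
    ← ENNReal.toReal_mul]
  exact congrArg _ this

/-- The tail of `statS` is at most of the order of the square of the normal tail. -/
lemma stdNormal_lt_statS_le [NeZero M] {c : ℝ} (hc : 0 ≤ c) :
    (stdNormal M).real {y | c < statS 1 y} ≤
      (M : ℝ) ^ 2 * (gaussianReal 0 1).real (Set.Ioi c) ^ 2 := by
  -- Since `c ≥ 0`, no coordinate is both above `c` and below `-c`. The two indices differ, and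
  -- independence gives the square.
  have hsub : {y : Fin M → ℝ | c < statS 1 y} ⊆
      ⋃ p ∈ (Finset.univ : Finset (Fin M × Fin M)).filter (fun p => p.1 ≠ p.2),
        ({y : Fin M → ℝ | c < y p.1} ∩ {y | y p.2 < -c}) := by
    intro y hy
    simp only [statS, Pi.one_apply, div_one, Set.mem_ofPred_eq, lt_min_iff] at hy
    obtain ⟨i, hi⟩ := exists_lt_of_lt_ciSup hy.1
    obtain ⟨j, hj⟩ := exists_lt_of_lt_ciSup hy.2
    simp only [Set.mem_iUnion]
    refine ⟨(i, j), ?_, hi, show y j < -c by linarith⟩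
    simp only [ne_eq, Finset.mem_filter, Finset.mem_univ, true_and]
    rintro rfl
    linarith
  refine (measureReal_mono hsub (measure_ne_top _ _)).trans
    ((measureReal_biUnion_finset_le _ _).trans ?_)
  rw [Finset.sum_congr rfl fun p hp => stdNormal_lt_and_lt (Finset.mem_filter.1 hp).2 c,
    Finset.sum_const, nsmul_eq_mul]
  refine mul_le_mul_of_nonneg_right ?_ (sq_nonneg _)
  have := Finset.card_filter_le (Finset.univ : Finset (Fin M × Fin M)) fun p => p.1 ≠ p.2
  rw [Finset.card_univ, Fintype.card_prod, Fintype.card_fin] at this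
  rw [sq]
  exact_mod_cast this

/-- For small levels, the limiting critical value `c` of `statS` is positive, is a point of strict
increase of the limiting distribution function, and is exceeded by a single standard normal
variable with probability larger than `α`. -/
lemma exists_critical_value (hM : 2 ≤ M) {γ : ℝ} (hγ : γ ∈ Set.Ioo (0 : ℝ) 1) :
    ∃ αbar ∈ Set.Ioc (0 : ℝ) (1 / 2), ∀ α ∈ Set.Ioo (0 : ℝ) αbar, ∃ c : ℝ,
      (stdNormal M).real {y | statS 1 y ≤ c} = 1 - α * γ ∧
        α < (gaussianReal 0 1).real (Set.Ioi c) := by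
  have : NeZero M := ⟨by omega⟩
  have hM0 : (0 : ℝ) < M := by exact_mod_cast (by omega : 0 < M)
  set F := fun c => (stdNormal M).real {y | statS 1 y ≤ c} with hFdef
  have hmono : StrictMono F := strictMono_stdNormal_statS hM
  have hcont : Continuous F :=
    continuous_measureReal_le continuous_statS_one.measurable stdNormal_statS_eq
  have hF0 : F 0 < 1 := (hmono one_pos).trans_le measureReal_le_one
  -- The bound `1 - F 0` makes the critical value nonnegative, as the tail estimate requires; `γ / M
  -- ^ 2` is what excludes a normal tail of at most `α`.
  refine ⟨min (1 / 2) (min (1 - F 0) (γ / M ^ 2)), ⟨?_, min_le_left _ _⟩, ?_⟩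
  · exact lt_min (by norm_num) (lt_min (by linarith) (div_pos hγ.1 (by positivity)))
  rintro α ⟨hα0, hα⟩
  obtain ⟨hα1, hα2, hα3⟩ : α < 1 / 2 ∧ α < 1 - F 0 ∧ α < γ / M ^ 2 := by simpa using hα
  have hαγ : α * γ < α := mul_lt_of_lt_one_right hα0 hγ.2
  have hαγ0 : 0 < α * γ := mul_pos hα0 hγ.1
  have htop : Tendsto F atTop (𝓝 1) := by
    have hprob : IsProbabilityMeasure ((stdNormal M).map (statS 1)) :=
      Measure.isProbabilityMeasure_map continuous_statS_one.measurable.aemeasurable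
    refine (tendsto_cdf_atTop ((stdNormal M).map (statS 1))).congr fun c => ?_
    rw [cdf_eq_real, map_measureReal_apply continuous_statS_one.measurable measurableSet_Iic]
    rfl
  obtain ⟨b, hb⟩ := (htop.eventually (lt_mem_nhds (by linarith : 1 - α * γ < 1))).exists
  have h0b : 0 ≤ b := by
    by_contra! h
    have := hmono h
    linarith
  obtain ⟨c, hc, hFc⟩ := intermediate_value_Icc h0b hcont.continuousOn
    (⟨by linarith, hb.le⟩ : 1 - α * γ ∈ Set.Icc (F 0) (F b))
  refine ⟨c, hFc, ?_⟩
  by_contra! hp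
  have htail : (stdNormal M).real {y | c < statS 1 y} = α * γ := by
    have := probReal_compl_eq_one_sub (μ := stdNormal M)
      (isClosed_le (continuous_statS_one (M := M)) (continuous_const (y := c))).measurableSet
    rw [Set.compl_ofPred] at this
    simp only [not_le] at this
    rw [this]
    change 1 - F c = _
    rw [hFc]; ring
  have hle := stdNormal_lt_statS_le (M := M) hc.1
  rw [htail] at hle
  have hp0 : 0 ≤ (gaussianReal 0 1).real (Set.Ioi c) := measureReal_nonneg
  -- Dividing by `α` gives `γ ≤ M² α`, against the choice of `αbar`.
  have h4 : α * γ ≤ (M : ℝ) ^ 2 * α ^ 2 := by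
    refine hle.trans ?_
    gcongr
  rw [lt_div_iff₀ (by positivity)] at hα3
  nlinarith

end StdNormal


/-! ### Bootstrap laws close to a weakly convergent sequence -/

section BootstrapLimit

lemma measurable_div_right {I : Type*} (s : I → ℝ) : Measurable fun y : I → ℝ => y / s := by
  fun_prop

/-- The supremum distance of two distribution functions. -/
def cdfDist {I : Type*} (μ ν : Measure (I → ℝ)) : ℝ :=
  ⨆ z : I → ℝ, |μ.real (Set.Iic z) - ν.real (Set.Iic z)|

lemma abs_sub_le_cdfDist {I : Type*} (μ ν : Measure (I → ℝ)) [IsProbabilityMeasure μ]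
    [IsProbabilityMeasure ν] (z : I → ℝ) :
    |μ.real (Set.Iic z) - ν.real (Set.Iic z)| ≤ cdfDist μ ν := by
  refine le_ciSup (f := fun z => |μ.real (Set.Iic z) - ν.real (Set.Iic z)|) ⟨1, ?_⟩ z
  rintro _ ⟨z, rfl⟩
  have h1 : μ.real (Set.Iic z) ≤ 1 := measureReal_le_one
  have h2 : ν.real (Set.Iic z) ≤ 1 := measureReal_le_one
  have h3 : 0 ≤ μ.real (Set.Iic z) := measureReal_nonneg
  have h4 : 0 ≤ ν.real (Set.Iic z) := measureReal_nonneg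
  exact abs_le.2 ⟨by linarith, by linarith⟩

variable {I : Type*} [Fintype I] {ι : Type*} {l : Filter ι}

/-- Along a weakly convergent sequence whose limit has no atoms in the coordinates, the
distribution functions converge at convergent sequences of points. -/
lemma tendsto_measureReal_Iic_of_tendsto {G : ι → ProbabilityMeasure (I → ℝ)}
    {ν : ProbabilityMeasure (I → ℝ)} (hG : Tendsto G l (𝓝 ν))
    (hν : ∀ m c, (ν : Measure (I → ℝ)) {y | y m = c} = 0) {z : ι → I → ℝ} {z₀ : I → ℝ}
    (hz : Tendsto z l (𝓝 z₀)) :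
    Tendsto (fun i => (G i : Measure (I → ℝ)).real (Set.Iic (z i))) l
      (𝓝 ((ν : Measure (I → ℝ)).real (Set.Iic z₀))) := by
  -- Carrying the moving point as a Dirac factor makes the set fixed: it becomes `{p | p.1 ≤ p.2}`,
  -- whose frontier is null for the limit law.
  have hprod : Tendsto (fun i => (G i).prod (diracProba (z i))) l (𝓝 (ν.prod (diracProba z₀))) :=
    (ProbabilityMeasure.continuous_prod.tendsto (ν, diracProba z₀)).comp
      (hG.prodMk_nhds ((continuous_diracProba.tendsto z₀).comp hz))
  have hmeas : MeasurableSet {p : (I → ℝ) × (I → ℝ) | p.1 ≤ p.2} :=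
    (isClosed_le continuous_fst continuous_snd).measurableSet
  have heq : ∀ (ρ : ProbabilityMeasure (I → ℝ)) (w : I → ℝ),
      ((ρ.prod (diracProba w) : ProbabilityMeasure _) : Measure ((I → ℝ) × (I → ℝ)))
        {p | p.1 ≤ p.2} = (ρ : Measure (I → ℝ)) (Set.Iic w) := by
    intro ρ w
    rw [ProbabilityMeasure.toMeasure_prod]
    change ((ρ : Measure (I → ℝ)).prod (Measure.dirac w)) _ = _
    rw [Measure.prod_dirac, Measure.map_apply (by fun_prop) hmeas]
    rfl
  have hfr : frontier {p : (I → ℝ) × (I → ℝ) | p.1 ≤ p.2} ⊆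
      ⋃ m, {p : (I → ℝ) × (I → ℝ) | p.1 m = p.2 m} := by
    have h1 : IsClosed {p : (I → ℝ) × (I → ℝ) | p.1 ≤ p.2} :=
      isClosed_le continuous_fst continuous_snd
    have h2 : IsOpen {p : (I → ℝ) × (I → ℝ) | ∀ m, p.1 m < p.2 m} := by
      rw [Set.ofPred_forall]
      exact isOpen_iInter_of_finite fun m => isOpen_lt (by fun_prop) (by fun_prop)
    intro p hp
    rw [h1.frontier_eq] at hp
    by_contra hne
    refine hp.2 (interior_maximal (fun q hq m => (hq m).le) h2 fun m => ?_)
    refine lt_of_le_of_ne (hp.1 m) fun h => hne (Set.mem_iUnion.2 ⟨m, h⟩)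
  have hnull : ((ν.prod (diracProba z₀) : ProbabilityMeasure _) : Measure ((I → ℝ) × (I → ℝ)))
      (frontier {p | p.1 ≤ p.2}) = 0 := by
    refine measure_mono_null hfr (measure_iUnion_null fun m => ?_)
    rw [ProbabilityMeasure.toMeasure_prod]
    change ((ν : Measure (I → ℝ)).prod (Measure.dirac z₀)) _ = _
    rw [Measure.prod_dirac, Measure.map_apply (by fun_prop)
      (measurableSet_eq_fun (by fun_prop) (by fun_prop))]
    exact hν m (z₀ m)
  have := ProbabilityMeasure.tendsto_measure_of_null_frontier_of_tendsto' hprod hnull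
  simp only [heq] at this
  exact (ENNReal.tendsto_toReal (by finiteness)).comp this

/-- Rescaling by `s i` evaluates the distribution function of `Q i` at the moving point `z * s i`,
which is why uniform closeness to `G i` is needed. -/
lemma tendsto_map_div_of_tendsto_cdfDist [l.IsCountablyGenerated]
    {G Q : ι → ProbabilityMeasure (I → ℝ)} {ν : ProbabilityMeasure (I → ℝ)}
    (hG : Tendsto G l (𝓝 ν)) (hν : ∀ m c, (ν : Measure (I → ℝ)) {y | y m = c} = 0)
    (hQ : Tendsto (fun i => cdfDist (Q i : Measure (I → ℝ)) (G i)) l (𝓝 0))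
    {s : ι → I → ℝ} {σ : I → ℝ} (hσ : ∀ m, 0 < σ m) (hs : Tendsto s l (𝓝 σ)) :
    Tendsto (fun i => (Q i).map (measurable_div_right (s i)).aemeasurable) l
      (𝓝 (ν.map (measurable_div_right σ).aemeasurable)) := by
  have hpre : ∀ (s : I → ℝ), (∀ m, 0 < s m) → ∀ (ρ : ProbabilityMeasure (I → ℝ)) z,
      ((ρ.map (measurable_div_right s).aemeasurable : ProbabilityMeasure _) :
        Measure (I → ℝ)).real (Set.Iic z) = (ρ : Measure (I → ℝ)).real (Set.Iic (z * s)) := by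
    intro s hs ρ z
    rw [ProbabilityMeasure.toMeasure_map,
      map_measureReal_apply (measurable_div_right s) measurableSet_Iic]
    congr 1
    ext y
    simp only [Set.mem_preimage, Set.mem_Iic, Pi.le_def, Pi.div_apply, Pi.mul_apply]
    exact forall_congr' fun m => div_le_iff₀ (hs m)
  refine tendsto_probabilityMeasure_of_tendsto_Iic fun z => ?_
  have hspos : ∀ᶠ i in l, ∀ m, 0 < s i m :=
    eventually_all.2 fun m => (tendsto_pi_nhds.1 hs m).eventually (lt_mem_nhds (hσ m))
  have hmain := tendsto_measureReal_Iic_of_tendsto hG hν (hs.const_mul z)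
  rw [hpre σ hσ]
  have hdiff : Tendsto (fun i => (Q i : Measure (I → ℝ)).real (Set.Iic (z * s i)) -
      (G i : Measure (I → ℝ)).real (Set.Iic (z * s i))) l (𝓝 0) :=
    squeeze_zero_norm (fun i => abs_sub_le_cdfDist _ _ _) hQ
  have := hdiff.add hmain
  simp only [sub_add_cancel, zero_add] at this
  refine this.congr' ?_
  filter_upwards [hspos] with i hi
  rw [hpre _ hi]

end BootstrapLimit

/-! ### Consequences of the standing assumptions -/

/-- Uncorrelated jointly Gaussian coordinates are independent. Diagonality of the covariance enters
the proof only here. -/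
lemma map_multivariateGaussian_eq_stdNormal {M : ℕ} {V : Matrix (Fin M) (Fin M) ℝ}
    (hV : V.PosSemidef) (hpos : ∀ m, 0 < V m m) (hdiag : V.IsDiag) :
    (multivariateGaussian 0 V).map (fun z => (WithLp.ofLp z : Fin M → ℝ) / fun m => √(V m m)) =
      stdNormal M := by
  have hind : iIndepFun (fun (m : Fin M) (z : EuclideanSpace ℝ (Fin M)) => z m)
      (multivariateGaussian 0 V) := by
    refine HasGaussianLaw.iIndepFun_of_covariance_eq_zero ?_ fun _ _ hij => ?_
    · have h : HasGaussianLaw id (multivariateGaussian (0 : EuclideanSpace ℝ (Fin M)) V) :=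
        IsGaussian.hasGaussianLaw_id
      exact h.map (EuclideanSpace.equiv (Fin M) ℝ : EuclideanSpace ℝ (Fin M) →L[ℝ] (Fin M → ℝ))
    · rw [covariance_eval_multivariateGaussian hV]
      exact hdiag hij
  have hmap : (multivariateGaussian 0 V).map (fun z => (WithLp.ofLp z : Fin M → ℝ)) =
      Measure.pi fun m => gaussianReal 0 (V m m).toNNReal := by
    have := (iIndepFun_iff_map_fun_eq_pi_map fun _ => by fun_prop).1 hind
    refine this.trans ?_
    congr 1
    ext1 m
    simpa using (measurePreserving_eval_multivariateGaussian (μ := 0) hV (i := m)).map_eq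
  have hcomp : (fun z : EuclideanSpace ℝ (Fin M) =>
      (WithLp.ofLp z : Fin M → ℝ) / fun m => √(V m m)) =
      (fun (y : Fin M → ℝ) m => y m / √(V m m)) ∘ fun z => (WithLp.ofLp z : Fin M → ℝ) := rfl
  rw [hcomp, ← Measure.map_map (by fun_prop) (by fun_prop), hmap,
    Measure.pi_map_pi (f := fun m (x : ℝ) => x / √(V m m)) fun m => by fun_prop]
  rw [stdNormal]
  congr 1
  ext1 m
  rw [gaussianReal_map_div_const, zero_div]
  congr 1
  ext
  simp [Real.sq_sqrt (hpos m).le, (hpos m).le, (hpos m).ne']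

namespace ForecastComparison

variable {M : ℕ} {X Y : Type*} [MeasurableSpace X] (S : ForecastComparison M X Y)

lemma measurable_sampleUpTo (n : ℕ) : Measurable (sampleUpTo n : (ℕ → X) → Fin n → X) :=
  measurable_pi_lambda _ fun _ => measurable_pi_apply _

lemma measurable_dHat (n : ℕ) : Measurable (S.dHat n) := by
  have := S.measurable_riskEst n
  refine measurable_pi_lambda _ fun m => ?_
  exact (measurable_pi_iff.1 this 0).sub (measurable_pi_iff.1 this m.succ)

lemma measurable_sigmaHat (n : ℕ) : Measurable (S.sigmaHat n) :=
  measurable_pi_lambda _ fun m => (measurable_pi_iff.1 (S.measurable_varEst n) m).sqrt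

lemma measurable_centred (n : ℕ) :
    Measurable fun p : (Fin n → X) × (Fin M → ℝ) => S.centred n p.1 p.2 := by
  have := (S.measurable_dHat n).comp
    (measurable_fst : Measurable (Prod.fst : (Fin n → X) × (Fin M → ℝ) → _))
  exact (measurable_snd.sub this).const_smul (√(n : ℝ))

lemma measurable_centred_right (n : ℕ) (x : Fin n → X) : Measurable (S.centred n x) :=
  (S.measurable_centred n).comp (measurable_const.prodMk measurable_id)

lemma measurable_scaledError (P : ProbabilityMeasure (ℕ → X)) (n : ℕ) :
    Measurable fun ω => √(n : ℝ) • (S.dHat n (sampleUpTo n ω) - S.riskDiff P) := by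
  have h : Measurable fun ω => S.dHat n (sampleUpTo n ω) :=
    (S.measurable_dHat n).comp (measurable_sampleUpTo n)
  fun_prop

variable {S} {P : ProbabilityMeasure (ℕ → X)} {V : Matrix (Fin M) (Fin M) ℝ}
  (hP : S.Assumptions P V)

include hP

lemma Assumptions.tendsto_sigmaHat :
    Tendsto (fun x : (Σ _ : ℕ, ℕ → X) => S.sigmaHat x.1 (sampleUpTo x.1 x.2))
      (inProb fun _ => (P : Measure (ℕ → X))) (𝓝 fun m => √(V m m)) := by
  rw [tendsto_pi_nhds]
  intro m
  have h := tendsto_inProb_of_tendstoInMeasure (hP.variance_consistent m)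
  exact h.sqrt

/-- Consistency follows from asymptotic normality: the error is `1 / √n` times a sequence converging
in law, so by Slutsky its limit law is the point mass at `0`, which does not charge the sphere of
radius `ε / 2`. -/
lemma Assumptions.tendsto_dHat :
    Tendsto (fun x : (Σ _ : ℕ, ℕ → X) => S.dHat x.1 (sampleUpTo x.1 x.2))
      (inProb fun _ => (P : Measure (ℕ → X))) (𝓝 (S.riskDiff P)) := by
  have hrate : Tendsto (fun n : ℕ => (√(n : ℝ))⁻¹) atTop (𝓝 0) :=
    tendsto_inv_atTop_zero.comp (Real.tendsto_sqrt_atTop.comp tendsto_natCast_atTop_atTop)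
  have hY : TendstoInMeasure (P : Measure (ℕ → X)) (fun (n : ℕ) _ => (√(n : ℝ))⁻¹) atTop
      (fun _ => (0 : ℝ)) :=
    tendstoInMeasure_of_tendsto_inProb (hrate.comp tendsto_fst_inProb)
  have hU := hP.normality.continuous_comp_prodMk_of_tendstoInMeasure_const
    (g := fun p : (Fin M → ℝ) × ℝ => p.2 • p.1) (by fun_prop) hY (fun _ => aemeasurable_const)
  rw [Metric.tendsto_nhds]
  intro ε hε
  rw [eventually_inProb_iff]
  have h := tendsto_measureReal_le_of_tendsto hU.tendsto (T := fun y : Fin M → ℝ => ‖y‖)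
    continuous_norm (c := ε / 2) (by
      rw [ProbabilityMeasure.coe_mk, Measure.map_apply (by fun_prop)
        (measurableSet_eq_fun (by fun_prop) (by fun_prop))]
      simp [(half_pos hε).ne])
  have hlim : (multivariateGaussian (0 : EuclideanSpace ℝ (Fin M)) V).map
      (fun ω => (0 : ℝ) • (WithLp.ofLp ω : Fin M → ℝ)) {y | ‖y‖ ≤ ε / 2} = 1 := by
    rw [Measure.map_apply (by fun_prop) (measurableSet_le (by fun_prop) (by fun_prop))]
    simp [(half_pos hε).le]
  simp only [ProbabilityMeasure.coe_mk, measureReal_def, hlim, ENNReal.toReal_one] at h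
  have hX : ∀ n : ℕ, Measurable fun ω =>
      (√(n : ℝ))⁻¹ • √(n : ℝ) • (S.dHat n (sampleUpTo n ω) - S.riskDiff P) := fun n =>
    (S.measurable_scaledError P n).fun_const_smul _
  have h' : Tendsto (fun n => (P : Measure (ℕ → X)) {ω | ¬ dist (S.dHat n (sampleUpTo n ω))
      (S.riskDiff P) ≤ ε / 2}) atTop (𝓝 0) := by
    have h2 := (ENNReal.tendsto_ofReal (h.const_sub 1))
    simp only [sub_self, ENNReal.ofReal_zero] at h2
    refine h2.congr' ?_
    filter_upwards [eventually_gt_atTop 0] with n hn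
    have hn' : √(n : ℝ) ≠ 0 := by positivity
    have hset : MeasurableSet {ω | ‖(√(n : ℝ))⁻¹ • √(n : ℝ) •
        (S.dHat n (sampleUpTo n ω) - S.riskDiff P)‖ ≤ ε / 2} :=
      measurableSet_le (hX n).norm measurable_const
    rw [Measure.map_apply (hX n) (measurableSet_le (by fun_prop) (by fun_prop))]
    have := probReal_compl_eq_one_sub (μ := (P : Measure (ℕ → X))) hset
    simp only [Set.preimage_ofPred_eq]
    rw [measureReal_def, measureReal_def] at this
    rw [← this, ENNReal.ofReal_toReal (by finiteness)]
    congr 1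
    ext ω
    simp [smul_smul, hn', dist_eq_norm]
  refine tendsto_of_tendsto_of_tendsto_of_le_of_le tendsto_const_nhds h' (fun _ => zero_le) ?_
  intro n
  refine measure_mono fun ω hω hle => hω (lt_of_le_of_lt hle (by linarith))

/-- The studentized estimation errors converge in distribution to independent standard normal
variables. -/
lemma Assumptions.tendstoInDistribution_studentized (hdiag : V.IsDiag) :
    TendstoInDistribution
      (fun (n : ℕ) ω => (√(n : ℝ) • (S.dHat n (sampleUpTo n ω) - S.riskDiff P)) *
        (S.sigmaHat n (sampleUpTo n ω))⁻¹) atTop (id : (Fin M → ℝ) → Fin M → ℝ)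
      (fun _ => (P : Measure (ℕ → X))) (stdNormal M) := by
  have hY : TendstoInMeasure (P : Measure (ℕ → X))
      (fun n ω => (S.sigmaHat n (sampleUpTo n ω))⁻¹) atTop (fun _ => (fun m => √(V m m))⁻¹) := by
    refine tendstoInMeasure_of_tendsto_inProb ?_
    rw [tendsto_pi_nhds]
    intro m
    exact (tendsto_pi_nhds.1 hP.tendsto_sigmaHat m).inv₀
      (Real.sqrt_ne_zero'.2 (hP.variance_pos m))
  -- Multiplying by the inverse, rather than dividing, makes the Slutsky map continuous everywhere.
  have hU := hP.normality.continuous_comp_prodMk_of_tendstoInMeasure_const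
    (g := fun p : (Fin M → ℝ) × (Fin M → ℝ) => p.1 * p.2) (by fun_prop) hY
    (fun n => ((S.measurable_sigmaHat n).comp (measurable_sampleUpTo n)).inv.aemeasurable)
  refine ⟨hU.forall_aemeasurable, aemeasurable_id, ?_⟩
  have hlim : (multivariateGaussian 0 V).map
      (fun z => (WithLp.ofLp z : Fin M → ℝ) * (fun m => √(V m m))⁻¹) =
      (stdNormal M).map id := by
    rw [Measure.map_id, ← map_multivariateGaussian_eq_stdNormal hP.posSemidef hP.variance_pos hdiag]
    rfl
  have := hU.tendsto
  simp only [hlim] at this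
  exact this

/-- The bootstrap law of the studentized replicates converges weakly, in probability, to the
standard normal law. -/
lemma Assumptions.tendsto_boot (hdiag : V.IsDiag) {T : (Fin M → ℝ) → ℝ} (hT : Continuous T) {c : ℝ}
    (hc : stdNormal M {y | T y = c} = 0) :
    Tendsto (fun x : (Σ _ : ℕ, ℕ → X) =>
        ((S.boot x.1 (sampleUpTo x.1 x.2)).map (S.centred x.1 (sampleUpTo x.1 x.2))).real
          {y | T (y / S.sigmaHat x.1 (sampleUpTo x.1 x.2)) ≤ c})
      (inProb fun _ => (P : Measure (ℕ → X))) (𝓝 ((stdNormal M).real {y | T y ≤ c})) := by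
  have hmk := S.isMarkovKernel_boot
  set σ : Fin M → ℝ := fun m => √(V m m) with hσ
  have hσpos : ∀ m, 0 < σ m := fun m => Real.sqrt_pos.2 (hP.variance_pos m)
  let G : ℕ → ProbabilityMeasure (Fin M → ℝ) := fun n =>
    ⟨(P : Measure (ℕ → X)).map fun ω => √(n : ℝ) • (S.dHat n (sampleUpTo n ω) - S.riskDiff P),
      Measure.isProbabilityMeasure_map (hP.normality.forall_aemeasurable n)⟩
  let ν : ProbabilityMeasure (Fin M → ℝ) :=
    ⟨(multivariateGaussian 0 V).map fun z => (WithLp.ofLp z : Fin M → ℝ),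
      Measure.isProbabilityMeasure_map hP.normality.aemeasurable_limit⟩
  have hG : Tendsto G atTop (𝓝 ν) := hP.normality.tendsto
  have hνmap : ((ν.map (measurable_div_right σ).aemeasurable : ProbabilityMeasure _) :
      Measure (Fin M → ℝ)) = stdNormal M := by
    rw [ProbabilityMeasure.toMeasure_map, ProbabilityMeasure.coe_mk,
      Measure.map_map (measurable_div_right σ) (by fun_prop)]
    exact map_multivariateGaussian_eq_stdNormal hP.posSemidef hP.variance_pos hdiag
  have hν : ∀ m c, (ν : Measure (Fin M → ℝ)) {y | y m = c} = 0 := by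
    intro m c
    have h := stdNormal_eval_mem_singleton m (c / σ m)
    rw [← hνmap, ProbabilityMeasure.toMeasure_map, Measure.map_apply (measurable_div_right σ)
      (measurableSet_eq_fun (by fun_prop) (by fun_prop))] at h
    convert h using 2
    ext y
    simp [div_left_inj' (hσpos m).ne']
  -- The filter `comap φ` is the coarsest along which `n → ∞`, the distance to `G n` vanishes and
  -- the scale tends to `σ`. It is countably generated, so the deterministic convergence result
  -- holds along it, and the random triple tends to it in probability.
  let φ : ℕ × ProbabilityMeasure (Fin M → ℝ) × (Fin M → ℝ) → ℕ × ℝ × (Fin M → ℝ) :=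
    fun p => (p.1, cdfDist (p.2.1 : Measure (Fin M → ℝ)) (G p.1), p.2.2)
  have hφ : Tendsto φ (comap φ (atTop ×ˢ 𝓝 0 ×ˢ 𝓝 σ)) (atTop ×ˢ 𝓝 0 ×ˢ 𝓝 σ) := tendsto_comap
  have hweak := tendsto_map_div_of_tendsto_cdfDist (l := comap φ (atTop ×ˢ 𝓝 0 ×ˢ 𝓝 σ))
    (G := fun p => G p.1) (Q := fun p => p.2.1) (s := fun p => p.2.2) (hG.comp hφ.fst) hν
    hφ.snd.fst hσpos hφ.snd.snd
  have hreal := tendsto_measureReal_le_of_tendsto hweak hT (c := c) (by rw [hνmap]; exact hc)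
  rw [hνmap] at hreal
  have hmeasT : MeasurableSet {y : Fin M → ℝ | T y ≤ c} :=
    measurableSet_le hT.measurable measurable_const
  have hin : Tendsto (fun x : (Σ _ : ℕ, ℕ → X) => ((x.1,
      ⟨(S.boot x.1 (sampleUpTo x.1 x.2)).map (S.centred x.1 (sampleUpTo x.1 x.2)),
        Measure.isProbabilityMeasure_map (S.measurable_centred_right _ _).aemeasurable⟩,
      S.sigmaHat x.1 (sampleUpTo x.1 x.2)) :
        ℕ × ProbabilityMeasure (Fin M → ℝ) × (Fin M → ℝ)))
      (inProb fun _ => (P : Measure (ℕ → X))) (comap φ (atTop ×ˢ 𝓝 0 ×ˢ 𝓝 σ)) := by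
    rw [tendsto_comap_iff]
    refine tendsto_fst_inProb.prodMk (Tendsto.prodMk ?_ hP.tendsto_sigmaHat)
    refine (tendsto_inProb_of_tendstoInMeasure hP.bootstrap_consistent).congr fun x => ?_
    refine iSup_congr fun z => ?_
    simp only [G, ProbabilityMeasure.coe_mk]
    rw [map_measureReal_apply (S.measurable_centred_right _ _) measurableSet_Iic,
      map_measureReal_apply (S.measurable_scaledError P x.1) measurableSet_Iic]
    rfl
  refine (hreal.comp hin).congr fun x => ?_
  simp only [Function.comp_apply, ProbabilityMeasure.toMeasure_map, ProbabilityMeasure.coe_mk]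
  rw [map_measureReal_apply (measurable_div_right _) hmeasT]
  rfl

end ForecastComparison


/-! ### The limiting rejection probability -/

section Limit

variable {M : ℕ} {γ α : ℝ}

/-- Only measurable sets enter the critical values. Hence relative frequencies may be replaced by
the empirical measure, with which they are only shown to agree on such sets. -/
lemma hybrid_congr {Q Q' : Set (Fin M → ℝ) → ℝ} (h : ∀ A, MeasurableSet A → Q A = Q' A)
    (s t : Fin M → ℝ) : hybrid s t Q γ α = hybrid s t Q' γ α := by
  have hS : critS s Q γ α = critS s Q' γ α := by
    simp only [critS]
    congr 1
    ext c
    exact h _ ((measurable_statS.comp (measurable_const.prodMk measurable_id)) measurableSet_Iic)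
  have hR : critR s Q γ α = critR s Q' γ α := by
    simp only [critR, hS]
    congr 1
    ext c
    exact h _ (((measurable_statR_mul_indicator _).comp
      (measurable_const.prodMk measurable_id)) measurableSet_Iic)
  rw [hybrid_eq_indicator, hybrid_eq_indicator, hS, hR]

lemma stdNormal_statR_le_lt [NeZero M] {c : ℝ} (hc : α < (gaussianReal 0 1).real (Set.Ioi c)) :
    (stdNormal M).real {y | statR 1 y ≤ c} < 1 - α := by
  have h := probReal_compl_eq_one_sub (μ := stdNormal M)
    (isClosed_le (continuous_statR_one (M := M)) (continuous_const (y := c))).measurableSet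
  have hle : (stdNormal M).real {y | c < y 0} ≤ (stdNormal M).real {y | statR 1 y ≤ c}ᶜ := by
    refine measureReal_mono fun y hy => ?_
    refine not_le.2 (lt_of_lt_of_le (show c < y 0 from hy) ?_)
    have := le_ciSup (bddAbove_range_of_finite fun m => y m / (1 : Fin M → ℝ) m) 0
    simpa [statR] using this
  rw [stdNormal_lt_eval] at hle
  linarith

variable {W : ℕ → Type*} [∀ n, MeasurableSpace (W n)] {ρ : ∀ n, Measure (W n)}
  [∀ n, IsProbabilityMeasure (ρ n)] {K : ∀ n, W n → Measure (Fin M → ℝ)}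
  [∀ n w, IsProbabilityMeasure (K n w)] {s t : ∀ n, W n → Fin M → ℝ}

/-- The rejection probability of the hybrid test converges to the limit of the tail probability
of `statS` at the limiting critical value. -/
lemma tendsto_integral_hybrid (hM : 2 ≤ M) (hα : α ∈ Set.Ioo (0 : ℝ) 1) (hγ : γ ∈ Set.Ioo (0 : ℝ) 1)
    (hK : ∀ n, Measurable (K n)) (hs : ∀ n, Measurable (s n)) (ht : ∀ n, Measurable (t n)) {c : ℝ}
    (hc : (stdNormal M).real {y | statS 1 y ≤ c} = 1 - α * γ)
    (hcα : α < (gaussianReal 0 1).real (Set.Ioi c))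
    (hKS : ∀ c, Tendsto (fun x : Σ n, W n => (K x.1 x.2).real {y | statS (s x.1 x.2) y ≤ c})
      (inProb ρ) (𝓝 ((stdNormal M).real {y | statS 1 y ≤ c})))
    (hKR : ∀ c, Tendsto (fun x : Σ n, W n => (K x.1 x.2).real {y | statR (s x.1 x.2) y ≤ c})
      (inProb ρ) (𝓝 ((stdNormal M).real {y | statR 1 y ≤ c})))
    (hST : ∀ c, ∀ᶠ x in inProb ρ, statS (s x.1 x.2) (t x.1 x.2) = statR (s x.1 x.2) (t x.1 x.2) ∨
      c < statS (s x.1 x.2) (t x.1 x.2))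
    {G : ℝ → ℝ} (hG : Continuous G)
    (hT : ∀ c, Tendsto (fun n => (ρ n).real {w | c < statS (s n w) (t n w)}) atTop (𝓝 (G c))) :
    Tendsto (fun n => ∫ w, hybrid (s n w) (t n w) (K n w).real γ α ∂(ρ n)) atTop (𝓝 (G c)) := by
  have : NeZero M := ⟨by omega⟩
  have hint : ∀ n, ∫ w, hybrid (s n w) (t n w) (K n w).real γ α ∂(ρ n) =
      (ρ n).real (rejectionEvent (K n) (s n) (t n) γ α) := by
    intro n
    simp only [hybrid_eq_indicator_rejectionEvent]
    rw [integral_indicator (measurableSet_rejectionEvent hα hγ (hK n) (hs n) (ht n))]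
    simp
  simp only [hint]
  have hmono := strictMono_stdNormal_statS hM
  have hRcont : Continuous fun c => (stdNormal M).real {y | statR 1 y ≤ c} :=
    continuous_measureReal_le continuous_statR_one.measurable stdNormal_statR_eq
  have hRε : ∀ᶠ ε in 𝓝[>] (0 : ℝ), (stdNormal M).real {y | statR 1 y ≤ c + ε} < 1 - α := by
    have h : Tendsto (fun ε => c + ε) (𝓝[>] (0 : ℝ)) (𝓝 c) := by
      simpa using
        (tendsto_id.mono_left nhdsWithin_le_nhds : Tendsto id (𝓝[>] (0 : ℝ)) _).const_add c
    exact ((hRcont.tendsto c).comp h).eventually (gt_mem_nhds (stdNormal_statR_le_lt hcα))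
  refine tendsto_measureReal_of_sandwich (T := fun n w => statS (s n w) (t n w)) hT
    hG.continuousAt ?_
  filter_upwards [hRε, self_mem_nhdsWithin] with ε hε3 hε
  have hε0 : 0 < ε := hε
  -- Strict increase separates `1 - α γ` from the limiting values at `c ± ε`, so the bootstrap
  -- values are on the correct sides with probability tending to one.
  have h1 := hmono (show c - ε < c by linarith)
  have h2 := hmono (show c < c + ε by linarith)
  simp only [hc] at h1 h2
  filter_upwards [(hKS (c - ε)).eventually (gt_mem_nhds h1),
    (hKS (c + ε)).eventually (lt_mem_nhds h2), (hKR (c + ε)).eventually (gt_mem_nhds hε3),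
    hST (c + 1)] with x hx1 hx2 hx3 hx4
  exact hybrid_sandwich hα hγ _ hε0 hx1 hx2 hx3 hx4

end Limit

/-! ### The simulated bootstrap distribution -/

section Empirical

variable {M B : ℕ}

/-- The empirical law of a tuple of vectors. -/
def empirical (v : Fin B → Fin M → ℝ) : Measure (Fin M → ℝ) :=
  (B : ENNReal)⁻¹ • ∑ b, Measure.dirac (v b)

lemma empirical_apply (v : Fin B → Fin M → ℝ) {A : Set (Fin M → ℝ)} (hA : MeasurableSet A) :
    empirical v A = (B : ENNReal)⁻¹ * ∑ b, A.indicator 1 (v b) := by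
  simp [empirical, Measure.finsetSum_apply, hA]

lemma isProbabilityMeasure_empirical (hB : B ≠ 0) (v : Fin B → Fin M → ℝ) :
    IsProbabilityMeasure (empirical v) := by
  refine ⟨?_⟩
  rw [empirical_apply v MeasurableSet.univ]
  simp [ENNReal.inv_mul_cancel, hB]

lemma empirical_real (v : Fin B → Fin M → ℝ) {A : Set (Fin M → ℝ)} (hA : MeasurableSet A) :
    (empirical v).real A = relFreq v A := by
  rw [measureReal_def, empirical_apply v hA, relFreq, ENNReal.toReal_mul, ENNReal.toReal_inv,
    ENNReal.toReal_natCast, one_div, ENNReal.toReal_sum]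
  · congr 1
    refine Finset.sum_congr rfl fun b _ => ?_
    by_cases h : v b ∈ A <;> simp [h]
  · intro b _
    by_cases h : v b ∈ A <;> simp [h]

lemma measurable_empirical :
    Measurable (empirical : (Fin B → Fin M → ℝ) → Measure (Fin M → ℝ)) := by
  refine Measure.measurable_of_measurable_coe _ fun A hA => ?_
  simp only [empirical_apply _ hA]
  refine Measurable.const_mul (Finset.measurable_sum _ fun b _ => ?_) _
  exact (measurable_one.indicator hA).comp (measurable_pi_apply b)

/-- Chebyshev's inequality for relative frequencies. -/
lemma pi_relFreq_deviation_le (μ : Measure (Fin M → ℝ)) [IsProbabilityMeasure μ] (hB : B ≠ 0)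
    {A : Set (Fin M → ℝ)} (hA : MeasurableSet A) {η : ℝ} (hη : 0 < η) :
    Measure.pi (fun _ : Fin B => μ) {v | η ≤ |relFreq v A - μ.real A|} ≤
      ENNReal.ofReal (1 / (B : ℝ) / η ^ 2) := by
  have hB0 : (B : ℝ) ≠ 0 := by exact_mod_cast hB
  have hmeas : Measurable (A.indicator fun _ => (1 : ℝ)) := measurable_const.indicator hA
  have hbound : ∀ y, A.indicator (fun _ => (1 : ℝ)) y ∈ Set.Icc (0 : ℝ) 1 := by
    intro y
    by_cases h : y ∈ A <;> simp [h]
  have hL2 : MemLp (A.indicator fun _ => (1 : ℝ)) 2 μ :=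
    memLp_of_bounded (ae_of_all _ hbound) hmeas.aestronglyMeasurable 2
  have heval : ∀ b : Fin B, MeasurePreserving (Function.eval b)
      (Measure.pi fun _ : Fin B => μ) μ := fun b => measurePreserving_eval _ b
  have hcomp : ∀ b : Fin B, MemLp
      (fun v : Fin B → Fin M → ℝ => A.indicator (fun _ => (1 : ℝ)) (v b)) 2 (Measure.pi fun _ : Fin B => μ) := fun b => hL2.comp_measurePreserving (heval b)
  have hrel : (fun v : Fin B → Fin M → ℝ => relFreq v A) =
      fun v => 1 / (B : ℝ) * (∑ b : Fin B, fun v : Fin B → Fin M → ℝ =>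
        A.indicator (fun _ => (1 : ℝ)) (v b)) v := by
    ext v
    simp [relFreq]
  have hsum := memLp_finsetSum' (Finset.univ : Finset (Fin B)) fun b _ => hcomp b
  have hLp : MemLp (fun v : Fin B → Fin M → ℝ => relFreq v A) 2
      (Measure.pi fun _ : Fin B => μ) := by
    rw [hrel]
    exact hsum.const_mul _
  have hmean : ∫ v, relFreq v A ∂(Measure.pi fun _ : Fin B => μ) = μ.real A := by
    simp only [relFreq]
    rw [integral_const_mul, integral_finsetSum _ fun b _ => (hcomp b).integrable (by norm_num)]
    have : ∀ b : Fin B, ∫ v : Fin B → Fin M → ℝ, A.indicator (fun _ => (1 : ℝ)) (v b)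
        ∂(Measure.pi fun _ : Fin B => μ) = μ.real A := by
      intro b
      have h := integral_map (μ := Measure.pi fun _ : Fin B => μ) (heval b).measurable.aemeasurable
        (f := A.indicator fun _ => (1 : ℝ)) hmeas.aestronglyMeasurable
      rw [(heval b).map_eq, integral_indicator hA] at h
      simpa using h.symm
    simp only [this, Finset.sum_const, Finset.card_univ, Fintype.card_fin, nsmul_eq_mul]
    field_simp
  have hvar : Var[fun v : Fin B → Fin M → ℝ => relFreq v A; Measure.pi fun _ : Fin B => μ] ≤
      1 / (B : ℝ) := by
    rw [hrel, variance_const_mul, variance_sum_pi fun _ => hL2]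
    have h1 : Var[A.indicator fun _ => (1 : ℝ); μ] ≤ 1 :=
      (variance_le_sq_of_bounded (ae_of_all _ hbound) hmeas.aemeasurable).trans (by norm_num)
    simp only [Finset.sum_const, Finset.card_univ, Fintype.card_fin, nsmul_eq_mul]
    calc (1 / (B : ℝ)) ^ 2 * (B * Var[A.indicator fun _ => (1 : ℝ); μ])
        = 1 / (B : ℝ) * Var[A.indicator fun _ => (1 : ℝ); μ] := by field_simp
      _ ≤ 1 / (B : ℝ) * 1 := by gcongr
      _ = 1 / (B : ℝ) := mul_one _
  have hcheb := meas_ge_le_variance_div_sq hLp hη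
  rw [hmean] at hcheb
  refine hcheb.trans (ENNReal.ofReal_le_ofReal ?_)
  gcongr

end Empirical

/-! ### The exact law of the centred replicate -/

namespace ForecastComparison

variable {M : ℕ} {X Y : Type*} [MeasurableSpace X] (S : ForecastComparison M X Y)

/-- The bootstrap law of the rescaled centred replicate, given the sample. -/
def bootLaw (n : ℕ) (ω : ℕ → X) : Measure (Fin M → ℝ) :=
  (S.boot n (sampleUpTo n ω)).map (S.centred n (sampleUpTo n ω))

instance (n : ℕ) (ω : ℕ → X) : IsProbabilityMeasure (S.bootLaw n ω) :=
  have := S.isMarkovKernel_boot n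
  Measure.isProbabilityMeasure_map (S.measurable_centred_right n _).aemeasurable

lemma measurable_bootLaw (n : ℕ) : Measurable (S.bootLaw n) := by
  have := S.isMarkovKernel_boot n
  refine Measure.measurable_of_measurable_coe _ fun A hA => ?_
  have h := (Kernel.measurable_kernel_prodMk_left (κ := S.boot n)
    (S.measurable_centred n hA)).comp (measurable_sampleUpTo n)
  convert h using 1
  ext ω
  rw [bootLaw, Measure.map_apply (S.measurable_centred_right n _) hA]
  rfl

end ForecastComparison


lemma measureReal_lt_eq_one_sub {E : Type*} [MeasurableSpace E] {μ : Measure E}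
    [IsProbabilityMeasure μ] {f : E → ℝ} (hf : Measurable f) (c : ℝ) :
    μ.real {y | c < f y} = 1 - μ.real {y | f y ≤ c} := by
  rw [← probReal_compl_eq_one_sub (measurableSet_le hf measurable_const)]
  congr 1
  ext y
  simp

/-! ### Asymptotics of the statistics and of the exact-bootstrap test -/

namespace ForecastComparison

variable {M : ℕ} {X Y : Type*} [MeasurableSpace X] {S : ForecastComparison M X Y}
  {P : ProbabilityMeasure (ℕ → X)} {V : Matrix (Fin M) (Fin M) ℝ} (hP : S.Assumptions P V)

lemma measurable_sigmaHat_sample (n : ℕ) :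
    Measurable fun ω : ℕ → X => S.sigmaHat n (sampleUpTo n ω) :=
  (S.measurable_sigmaHat n).comp (measurable_sampleUpTo n)

lemma measurable_dHat_sample (n : ℕ) :
    Measurable fun ω : ℕ → X => √(n : ℝ) • S.dHat n (sampleUpTo n ω) := by
  have h : Measurable fun ω : ℕ → X => S.dHat n (sampleUpTo n ω) :=
    (S.measurable_dHat n).comp (measurable_sampleUpTo n)
  fun_prop

lemma measurable_statS_sample (n : ℕ) : Measurable fun ω : ℕ → X =>
    statS (S.sigmaHat n (sampleUpTo n ω)) (√(n : ℝ) • S.dHat n (sampleUpTo n ω)) :=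
  measurable_statS.comp ((measurable_sigmaHat_sample n).prodMk (measurable_dHat_sample n))

include hP

lemma Assumptions.tendsto_ratio (m : Fin M) :
    Tendsto (fun x : (Σ _ : ℕ, ℕ → X) => S.dHat x.1 (sampleUpTo x.1 x.2) m /
      S.sigmaHat x.1 (sampleUpTo x.1 x.2) m) (inProb fun _ => (P : Measure (ℕ → X)))
      (𝓝 (S.riskDiff P m / √(V m m))) :=
  (tendsto_pi_nhds.1 hP.tendsto_dHat m).div (tendsto_pi_nhds.1 hP.tendsto_sigmaHat m)
    (Real.sqrt_ne_zero'.2 (hP.variance_pos m))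

/-- If some alternative is better and some is worse than the benchmark, `statS` diverges. -/
lemma Assumptions.eventually_lt_statS {i j : Fin M} (hi : 0 < S.riskDiff P i)
    (hj : S.riskDiff P j < 0) (c : ℝ) :
    ∀ᶠ x : (Σ _ : ℕ, ℕ → X) in inProb fun _ => (P : Measure (ℕ → X)),
      c < statS (S.sigmaHat x.1 (sampleUpTo x.1 x.2))
        (√(x.1 : ℝ) • S.dHat x.1 (sampleUpTo x.1 x.2)) := by
  have hn : Tendsto (fun x : (Σ _ : ℕ, ℕ → X) => √(x.1 : ℝ))
      (inProb fun _ => (P : Measure (ℕ → X))) atTop :=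
    (Real.tendsto_sqrt_atTop.comp tendsto_natCast_atTop_atTop).comp tendsto_fst_inProb
  have h1 := hn.atTop_mul_pos
    (div_pos hi (Real.sqrt_pos.2 (hP.variance_pos i))) (hP.tendsto_ratio i)
  have h2 := hn.atTop_mul_pos (neg_pos.2
    (div_neg_of_neg_of_pos hj (Real.sqrt_pos.2 (hP.variance_pos j)))) (hP.tendsto_ratio j).neg
  filter_upwards [h1.eventually_gt_atTop c, h2.eventually_gt_atTop c] with x hx1 hx2
  refine lt_min ?_ ?_
  · refine lt_of_lt_of_le ?_ (le_ciSup (bddAbove_range_of_finite _) i)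
    simpa [mul_div_assoc] using hx1
  · refine lt_of_lt_of_le ?_ (le_ciSup (bddAbove_range_of_finite _) j)
    simpa [mul_div_assoc] using hx2

/-- Under the null hypothesis with a binding and a non-binding inequality, both statistics
coincide with the maximum of the studentized errors over the binding inequalities. -/
lemma Assumptions.eventually_statS_eq (hd : S.riskDiff P ≤ 0) (h_zero : ∃ m, S.riskDiff P m = 0)
    (h_neg : ∃ m, S.riskDiff P m < 0) :
    ∀ᶠ x : (Σ _ : ℕ, ℕ → X) in inProb fun _ => (P : Measure (ℕ → X)),
      statR (S.sigmaHat x.1 (sampleUpTo x.1 x.2))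
        (√(x.1 : ℝ) • S.dHat x.1 (sampleUpTo x.1 x.2)) =
        (⨆ i : {m // S.riskDiff P m = 0}, ((√(x.1 : ℝ) • (S.dHat x.1 (sampleUpTo x.1 x.2) -
          S.riskDiff P)) * (S.sigmaHat x.1 (sampleUpTo x.1 x.2))⁻¹) i) ∧
      statS (S.sigmaHat x.1 (sampleUpTo x.1 x.2))
        (√(x.1 : ℝ) • S.dHat x.1 (sampleUpTo x.1 x.2)) =
      statR (S.sigmaHat x.1 (sampleUpTo x.1 x.2))
        (√(x.1 : ℝ) • S.dHat x.1 (sampleUpTo x.1 x.2)) := by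
  obtain ⟨i₀, hi₀⟩ := h_zero
  obtain ⟨j, hj⟩ := h_neg
  have hpos := fun m => Real.sqrt_pos.2 (hP.variance_pos m)
  have hne : Nonempty {m // S.riskDiff P m = 0} := ⟨⟨i₀, hi₀⟩⟩
  have : Nonempty (Fin M) := ⟨i₀⟩
  -- Before scaling by `√n`, the binding ratios tend to `0` and the others to negative limits. Hence
  -- non-binding indices lose the maximum to `i₀`, and minus the ratio at `j` beats every binding
  -- ratio.
  have h1 : ∀ᶠ x : (Σ _ : ℕ, ℕ → X) in inProb fun _ => (P : Measure (ℕ → X)),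
      ∀ m, S.riskDiff P m < 0 → S.dHat x.1 (sampleUpTo x.1 x.2) m /
        S.sigmaHat x.1 (sampleUpTo x.1 x.2) m < S.dHat x.1 (sampleUpTo x.1 x.2) i₀ /
        S.sigmaHat x.1 (sampleUpTo x.1 x.2) i₀ := by
    refine eventually_all.2 fun m => ?_
    by_cases hm : S.riskDiff P m < 0
    · refine ((hP.tendsto_ratio m).eventually_lt (hP.tendsto_ratio i₀) ?_).mono fun _ h _ => h
      rw [hi₀, zero_div]
      exact div_neg_of_neg_of_pos hm (hpos m)
    · simp [hm]
  have h2 : ∀ᶠ x : (Σ _ : ℕ, ℕ → X) in inProb fun _ => (P : Measure (ℕ → X)),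
      ∀ m, S.riskDiff P m = 0 → S.dHat x.1 (sampleUpTo x.1 x.2) m /
        S.sigmaHat x.1 (sampleUpTo x.1 x.2) m < -(S.dHat x.1 (sampleUpTo x.1 x.2) j /
        S.sigmaHat x.1 (sampleUpTo x.1 x.2) j) := by
    refine eventually_all.2 fun m => ?_
    by_cases hm : S.riskDiff P m = 0
    · refine ((hP.tendsto_ratio m).eventually_lt (hP.tendsto_ratio j).neg ?_).mono fun _ h _ => h
      rw [hm, zero_div]
      exact neg_pos.2 (div_neg_of_neg_of_pos hj (hpos j))
    · simp [hm]
  filter_upwards [h1, h2] with x hx1 hx2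
  set d := S.dHat x.1 (sampleUpTo x.1 x.2)
  set s := S.sigmaHat x.1 (sampleUpTo x.1 x.2)
  set r := √(x.1 : ℝ)
  have hr : 0 ≤ r := Real.sqrt_nonneg _
  have hbind : ∀ i : {m // S.riskDiff P m = 0},
      ((r • (d - S.riskDiff P)) * s⁻¹) i = r * (d i / s i) := by
    intro i
    simp only [Pi.mul_apply, Pi.smul_apply, Pi.sub_apply, i.2, Pi.inv_apply, smul_eq_mul]
    ring
  have hval : ∀ m, (r • d) m / s m = r * (d m / s m) := by
    intro m
    simp only [Pi.smul_apply, smul_eq_mul]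
    ring
  have hmax : statR s (r • d) =
      ⨆ i : {m // S.riskDiff P m = 0}, ((r • (d - S.riskDiff P)) * s⁻¹) i := by
    simp only [statR, hbind, hval]
    refine le_antisymm (ciSup_le fun m => ?_) (ciSup_le fun i => ?_)
    · rcases (hd m).eq_or_lt with hm | hm
      · exact le_ciSup (f := fun i : {m // S.riskDiff P m = 0} => r * (d i / s i))
          (bddAbove_range_of_finite _) ⟨m, hm⟩
      · exact (mul_le_mul_of_nonneg_left (hx1 m hm).le hr).trans
          (le_ciSup (f := fun i : {m // S.riskDiff P m = 0} => r * (d i / s i))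
            (bddAbove_range_of_finite _) ⟨i₀, hi₀⟩)
    · exact le_ciSup (f := fun m => r * (d m / s m)) (bddAbove_range_of_finite _) i.1
  refine ⟨hmax, min_eq_left ?_⟩
  change statR s (r • d) ≤ _
  rw [hmax]
  refine ciSup_le fun i => ?_
  rw [hbind]
  refine le_trans ?_ (le_ciSup (bddAbove_range_of_finite _) j)
  rw [hval, ← mul_neg]
  exact mul_le_mul_of_nonneg_left (hx2 i i.2).le hr

/-- The tail probabilities of `statS` converge to a continuous function that dominates the tail of
the standard normal law. -/
lemma Assumptions.exists_tail_limit (hdiag : V.IsDiag) (h_zero : ∃ m, S.riskDiff P m = 0)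
    (h_neg : ∃ m, S.riskDiff P m < 0) :
    ∃ G : ℝ → ℝ, Continuous G ∧ (∀ c, (gaussianReal 0 1).real (Set.Ioi c) ≤ G c) ∧
      (∀ c, Tendsto (fun n : ℕ => (P : Measure (ℕ → X)).real {ω | c <
        statS (S.sigmaHat n (sampleUpTo n ω)) (√(n : ℝ) • S.dHat n (sampleUpTo n ω))}) atTop
        (𝓝 (G c))) ∧
      ∀ c, ∀ᶠ x : (Σ _ : ℕ, ℕ → X) in inProb fun _ => (P : Measure (ℕ → X)),
        statS (S.sigmaHat x.1 (sampleUpTo x.1 x.2))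
          (√(x.1 : ℝ) • S.dHat x.1 (sampleUpTo x.1 x.2)) =
        statR (S.sigmaHat x.1 (sampleUpTo x.1 x.2))
          (√(x.1 : ℝ) • S.dHat x.1 (sampleUpTo x.1 x.2)) ∨
        c < statS (S.sigmaHat x.1 (sampleUpTo x.1 x.2))
          (√(x.1 : ℝ) • S.dHat x.1 (sampleUpTo x.1 x.2)) := by
  -- The null hypothesis is not assumed here. If it fails, some positive `d_i` together with a
  -- negative `d_j` makes `statS` diverge, and `G = 1`.
  by_cases hd : S.riskDiff P ≤ 0
  · obtain ⟨i₀, hi₀⟩ := h_zero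
    have hne : Nonempty {m // S.riskDiff P m = 0} := ⟨⟨i₀, hi₀⟩⟩
    have hev := hP.eventually_statS_eq hd ⟨i₀, hi₀⟩ h_neg
    set T : (Fin M → ℝ) → ℝ := fun y => ⨆ i : {m // S.riskDiff P m = 0}, y i with hT
    have hTc : Continuous T := continuous_ciSup_of_finite fun i => continuous_apply _
    have hTnull : ∀ c, stdNormal M {y | T y = c} = 0 := fun c =>
      stdNormal_ciSup_eq (fun i : {m // S.riskDiff P m = 0} => (i : Fin M)) c
    have hG : Continuous fun c => (stdNormal M).real {y | c < T y} := by
      simp only [measureReal_lt_eq_one_sub hTc.measurable]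
      exact continuous_const.sub (continuous_measureReal_le hTc.measurable hTnull)
    refine ⟨fun c => (stdNormal M).real {y | c < T y}, hG, fun c => ?_, fun c => ?_, fun c => ?_⟩
    · rw [← stdNormal_lt_eval i₀]
      refine measureReal_mono fun y hy => ?_
      exact lt_of_lt_of_le (show c < y i₀ from hy)
        (le_ciSup (f := fun i : {m // S.riskDiff P m = 0} => y i)
          (bddAbove_range_of_finite _) ⟨i₀, hi₀⟩)
    · have hstud := hP.tendstoInDistribution_studentized hdiag
      have hYm : ∀ n : ℕ, Measurable fun ω => (√(n : ℝ) • (S.dHat n (sampleUpTo n ω) -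
          S.riskDiff P)) * (S.sigmaHat n (sampleUpTo n ω))⁻¹ := fun n =>
        (S.measurable_scaledError P n).mul (measurable_sigmaHat_sample n).inv
      refine tendsto_measureReal_of_sandwich (T := fun n ω => T ((√(n : ℝ) •
        (S.dHat n (sampleUpTo n ω) - S.riskDiff P)) * (S.sigmaHat n (sampleUpTo n ω))⁻¹))
        (G := fun c => (stdNormal M).real {y | c < T y}) (fun c' => ?_) hG.continuousAt ?_
      · have h := tendsto_measureReal_le_of_tendsto hstud.tendsto hTc (c := c') (by
          simpa using hTnull c')
        simp only [ProbabilityMeasure.coe_mk, Measure.map_id] at h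
        rw [measureReal_lt_eq_one_sub hTc.measurable]
        refine (h.const_sub 1).congr fun n => ?_
        rw [measureReal_lt_eq_one_sub (hTc.measurable.fun_comp (hYm n)),
          map_measureReal_apply (hYm n) (measurableSet_le hTc.measurable measurable_const)]
        rfl
      · filter_upwards [self_mem_nhdsWithin] with ε hε
        have hε0 : 0 < ε := hε
        filter_upwards [hev] with x hx
        simp only [hx.2, hx.1]
        exact ⟨fun h => lt_trans (by linarith) h, fun h => lt_trans (by linarith) h⟩
    · filter_upwards [hev] with x hx using Or.inl hx.2
  · obtain ⟨j, hj⟩ := h_neg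
    obtain ⟨i, hi⟩ : ∃ i, 0 < S.riskDiff P i := by
      simpa [Pi.le_def] using hd
    have hev := hP.eventually_lt_statS hi hj
    refine ⟨fun _ => 1, continuous_const, fun c => measureReal_le_one, fun c => ?_,
      fun c => (hev c).mono fun _ h => Or.inr h⟩
    have h := (ENNReal.tendsto_toReal ENNReal.zero_ne_top).comp (eventually_inProb_iff.1 (hev c))
    have h' := h.const_sub 1
    simp only [ENNReal.toReal_zero, sub_zero] at h'
    refine h'.congr fun n => ?_
    rw [measureReal_lt_eq_one_sub (measurable_statS_sample n)]
    simp [measureReal_def]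

lemma Assumptions.tendsto_bootLaw_statS [NeZero M] (hdiag : V.IsDiag) (c : ℝ) :
    Tendsto (fun x : (Σ _ : ℕ, ℕ → X) => (S.bootLaw x.1 x.2).real
        {y | statS (S.sigmaHat x.1 (sampleUpTo x.1 x.2)) y ≤ c})
      (inProb fun _ => (P : Measure (ℕ → X))) (𝓝 ((stdNormal M).real {y | statS 1 y ≤ c})) := by
  simpa only [← statS_eq_statS_one, bootLaw] using
    hP.tendsto_boot hdiag continuous_statS_one (stdNormal_statS_eq c)

lemma Assumptions.tendsto_bootLaw_statR [NeZero M] (hdiag : V.IsDiag) (c : ℝ) :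
    Tendsto (fun x : (Σ _ : ℕ, ℕ → X) => (S.bootLaw x.1 x.2).real
        {y | statR (S.sigmaHat x.1 (sampleUpTo x.1 x.2)) y ≤ c})
      (inProb fun _ => (P : Measure (ℕ → X))) (𝓝 ((stdNormal M).real {y | statR 1 y ≤ c})) := by
  simpa only [← statR_eq_statR_one, bootLaw] using
    hP.tendsto_boot hdiag continuous_statR_one (stdNormal_statR_eq c)

/-- The limit of the rejection probability with the exact bootstrap law. -/
lemma Assumptions.tendsto_rejectionProb_hybridExact (hM : 2 ≤ M) (hdiag : V.IsDiag) {γ α : ℝ}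
    (hα : α ∈ Set.Ioo (0 : ℝ) 1) (hγ : γ ∈ Set.Ioo (0 : ℝ) 1) {c : ℝ}
    (hc : (stdNormal M).real {y | statS 1 y ≤ c} = 1 - α * γ)
    (hcα : α < (gaussianReal 0 1).real (Set.Ioi c)) {G : ℝ → ℝ} (hG : Continuous G)
    (hT : ∀ c, Tendsto (fun n : ℕ => (P : Measure (ℕ → X)).real {ω | c <
      statS (S.sigmaHat n (sampleUpTo n ω)) (√(n : ℝ) • S.dHat n (sampleUpTo n ω))}) atTop
      (𝓝 (G c)))
    (hST : ∀ c, ∀ᶠ x : (Σ _ : ℕ, ℕ → X) in inProb fun _ => (P : Measure (ℕ → X)),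
      statS (S.sigmaHat x.1 (sampleUpTo x.1 x.2))
        (√(x.1 : ℝ) • S.dHat x.1 (sampleUpTo x.1 x.2)) =
      statR (S.sigmaHat x.1 (sampleUpTo x.1 x.2))
        (√(x.1 : ℝ) • S.dHat x.1 (sampleUpTo x.1 x.2)) ∨
      c < statS (S.sigmaHat x.1 (sampleUpTo x.1 x.2))
        (√(x.1 : ℝ) • S.dHat x.1 (sampleUpTo x.1 x.2))) :
    Tendsto (rejectionProb (S.hybridExact γ α) P) atTop (𝓝 (G c)) := by
  have : NeZero M := ⟨by omega⟩
  have h := tendsto_integral_hybrid (ρ := fun _ => (P : Measure (ℕ → X))) (K := S.bootLaw)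
    (s := fun n ω => S.sigmaHat n (sampleUpTo n ω))
    (t := fun n ω => √(n : ℝ) • S.dHat n (sampleUpTo n ω)) hM hα hγ S.measurable_bootLaw
    measurable_sigmaHat_sample measurable_dHat_sample hc hcα (hP.tendsto_bootLaw_statS hdiag)
    (hP.tendsto_bootLaw_statR hdiag) hST hG hT
  refine h.congr fun n => integral_congr_ae (ae_of_all _ fun ω => ?_)
  refine hybrid_congr (fun A hA => ?_) _ _
  exact map_measureReal_apply (S.measurable_centred_right n _) hA

end ForecastComparison


/-! ### The joint law of the series and the simulated replicates -/

namespace ForecastComparison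

variable {M : ℕ} {X Y : Type*} [MeasurableSpace X] (S : ForecastComparison M X Y)

lemma measurable_pi_boot (n b : ℕ) :
    Measurable fun ω : ℕ → X => Measure.pi fun _ : Fin b => S.boot n (sampleUpTo n ω) := by
  have := S.isMarkovKernel_boot n
  refine .measure_of_isPiSystem_of_isProbabilityMeasure generateFrom_pi.symm isPiSystem_pi ?_
  rintro _ ⟨A, hA, rfl⟩
  simp only [Measure.pi_pi]
  refine Finset.measurable_prod _ fun i _ => ?_
  exact ((S.boot n).measurable_coe (hA i (Set.mem_univ i))).comp (measurable_sampleUpTo n)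

/-- The conditional law, given the series, of `b` independent bootstrap replicates. -/
def replicates (n b : ℕ) : Kernel (ℕ → X) (Fin b → Fin M → ℝ) :=
  ⟨fun ω => Measure.pi fun _ : Fin b => S.boot n (sampleUpTo n ω), S.measurable_pi_boot n b⟩

instance (n b : ℕ) : IsMarkovKernel (S.replicates n b) :=
  ⟨fun ω => by
    have := S.isMarkovKernel_boot n
    exact inferInstanceAs (IsProbabilityMeasure
      (Measure.pi fun _ : Fin b => S.boot n (sampleUpTo n ω)))⟩

/-- The empirical law of the rescaled centred replicates. -/
def empiricalBootLaw (n b : ℕ) (w : (ℕ → X) × (Fin b → Fin M → ℝ)) : Measure (Fin M → ℝ) :=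
  empirical fun i => S.centred n (sampleUpTo n w.1) (w.2 i)

lemma measurable_empiricalBootLaw (n b : ℕ) : Measurable (S.empiricalBootLaw n b) := by
  refine measurable_empirical.comp (measurable_pi_lambda _ fun i => ?_)
  exact (S.measurable_centred n).comp (((measurable_sampleUpTo n).comp measurable_fst).prodMk
    ((measurable_pi_apply i).comp measurable_snd))

lemma relFreq_centred (n b : ℕ) (x : Fin n → X) (v : Fin b → Fin M → ℝ) (A : Set (Fin M → ℝ)) :
    relFreq (fun i => S.centred n x (v i)) A = relFreq v (S.centred n x ⁻¹' A) := rfl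

/-- Given the series, the set is fixed and the replicates are independent, so Chebyshev applies. Its
bound depends neither on the series nor on the set and survives integration. -/
lemma compProd_deviation_le (P : ProbabilityMeasure (ℕ → X)) {n b : ℕ} (hb : b ≠ 0)
    {A : (ℕ → X) → Set (Fin M → ℝ)}
    (hA : MeasurableSet {p : (ℕ → X) × (Fin M → ℝ) | p.2 ∈ A p.1}) {η : ℝ} (hη : 0 < η) :
    ((P : Measure (ℕ → X)) ⊗ₘ S.replicates n b)
      {w | η ≤ |(S.empiricalBootLaw n b w).real (A w.1) - (S.bootLaw n w.1).real (A w.1)|} ≤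
      ENNReal.ofReal (1 / (b : ℝ) / η ^ 2) := by
  have := S.isMarkovKernel_boot n
  have hprob : ∀ w, IsProbabilityMeasure (S.empiricalBootLaw n b w) := fun _ =>
    isProbabilityMeasure_empirical hb _
  have hAω : ∀ ω, MeasurableSet (A ω) := fun ω => measurable_prodMk_left hA
  have hmeas : MeasurableSet {w : (ℕ → X) × (Fin b → Fin M → ℝ) |
      η ≤ |(S.empiricalBootLaw n b w).real (A w.1) - (S.bootLaw n w.1).real (A w.1)|} := by
    refine measurableSet_le measurable_const (Measurable.abs (Measurable.sub ?_ ?_))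
    · refine measurable_measureReal_section (S.measurable_empiricalBootLaw n b)
        (A := fun w => A w.1) ?_
      exact ((measurable_fst.comp measurable_fst).prodMk measurable_snd) hA
    · exact (measurable_measureReal_section (S.measurable_bootLaw n) hA).comp measurable_fst
  rw [Measure.compProd_apply hmeas]
  calc _ ≤ ∫⁻ _, ENNReal.ofReal (1 / (b : ℝ) / η ^ 2) ∂(P : Measure (ℕ → X)) := by
        refine lintegral_mono fun ω => ?_
        refine le_trans (le_of_eq ?_) (pi_relFreq_deviation_le (S.boot n (sampleUpTo n ω)) hb
          (S.measurable_centred_right n (sampleUpTo n ω) (hAω ω)) hη)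
        refine congrArg (Measure.pi fun _ : Fin b => S.boot n (sampleUpTo n ω)) ?_
        ext v
        simp only [Set.mem_preimage, Set.mem_ofPred_eq, empiricalBootLaw, bootLaw,
          empirical_real _ (hAω ω), relFreq_centred,
          map_measureReal_apply (S.measurable_centred_right n _) (hAω ω)]
    _ = _ := by simp

/-- The first marginal of the joint law is `P`, so limits in probability that concern the series
alone persist when the replicates are adjoined. -/
lemma tendsto_fst_compProd (P : ProbabilityMeasure (ℕ → X)) (B : ℕ → ℕ) :
    Tendsto (fun w : (Σ n, (ℕ → X) × (Fin (B n) → Fin M → ℝ)) =>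
        (⟨w.1, w.2.1⟩ : Σ _ : ℕ, ℕ → X))
      (inProb fun n => (P : Measure (ℕ → X)) ⊗ₘ S.replicates n (B n))
      (inProb fun _ => (P : Measure (ℕ → X))) := by
  intro U hU
  change Tendsto _ _ _
  refine tendsto_of_tendsto_of_tendsto_of_le_of_le tendsto_const_nhds hU (fun _ => zero_le) ?_
  intro n
  have h := Measure.le_map_apply (μ := (P : Measure (ℕ → X)) ⊗ₘ S.replicates n (B n))
    measurable_fst.aemeasurable {ω | (⟨n, ω⟩ : Σ _ : ℕ, ℕ → X) ∉ U}
  have hfst : ((P : Measure (ℕ → X)) ⊗ₘ S.replicates n (B n)).map Prod.fst = P :=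
    Measure.fst_compProd _ _
  rw [hfst] at h
  exact h

lemma tendsto_empiricalBootLaw (P : ProbabilityMeasure (ℕ → X)) {B : ℕ → ℕ}
    (hB : Tendsto B atTop atTop) (hB0 : ∀ n, B n ≠ 0) {A : ∀ _ : ℕ, (ℕ → X) → Set (Fin M → ℝ)}
    (hA : ∀ n, MeasurableSet {p : (ℕ → X) × (Fin M → ℝ) | p.2 ∈ A n p.1}) {a : ℝ}
    (h : Tendsto (fun x : (Σ _ : ℕ, ℕ → X) => (S.bootLaw x.1 x.2).real (A x.1 x.2))
      (inProb fun _ => (P : Measure (ℕ → X))) (𝓝 a)) :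
    Tendsto (fun w : (Σ n, (ℕ → X) × (Fin (B n) → Fin M → ℝ)) =>
        (S.empiricalBootLaw w.1 (B w.1) w.2).real (A w.1 w.2.1))
      (inProb fun n => (P : Measure (ℕ → X)) ⊗ₘ S.replicates n (B n)) (𝓝 a) := by
  have hdiff : Tendsto (fun w : (Σ n, (ℕ → X) × (Fin (B n) → Fin M → ℝ)) =>
      (S.empiricalBootLaw w.1 (B w.1) w.2).real (A w.1 w.2.1) -
        (S.bootLaw w.1 w.2.1).real (A w.1 w.2.1))
      (inProb fun n => (P : Measure (ℕ → X)) ⊗ₘ S.replicates n (B n)) (𝓝 0) := by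
    rw [Metric.tendsto_nhds]
    intro η hη
    rw [eventually_inProb_iff]
    have hlim : Tendsto (fun n => ENNReal.ofReal (1 / (B n : ℝ) / η ^ 2)) atTop (𝓝 0) := by
      have h1 : Tendsto (fun n => 1 / (B n : ℝ) / η ^ 2) atTop (𝓝 0) := by
        have := (tendsto_one_div_atTop_nhds_zero_nat (𝕜 := ℝ)).comp hB
        simpa using this.div_const (η ^ 2)
      simpa using ENNReal.tendsto_ofReal h1
    refine tendsto_of_tendsto_of_tendsto_of_le_of_le tendsto_const_nhds hlim (fun _ => zero_le) ?_
    intro n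
    refine le_trans (le_of_eq ?_) (S.compProd_deviation_le P (n := n) (hB0 n) (hA n) hη)
    refine congrArg ((P : Measure (ℕ → X)) ⊗ₘ S.replicates n (B n)) ?_
    ext w
    simp
  have := hdiff.add (h.comp (S.tendsto_fst_compProd P B))
  simpa [Function.comp_def] using this

lemma rejectionProb_hybridMC (P : ProbabilityMeasure (ℕ → X)) {γ α : ℝ}
    (hα : α ∈ Set.Ioo (0 : ℝ) 1) (hγ : γ ∈ Set.Ioo (0 : ℝ) 1) (B : ℕ → ℕ) (n : ℕ)
    (hB : B n ≠ 0) :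
    rejectionProb (S.hybridMC B γ α) P n =
      ∫ w, hybrid (S.sigmaHat n (sampleUpTo n w.1)) (√(n : ℝ) • S.dHat n (sampleUpTo n w.1))
        (S.empiricalBootLaw n (B n) w).real γ α
        ∂((P : Measure (ℕ → X)) ⊗ₘ S.replicates n (B n)) := by
  have hprob : ∀ w, IsProbabilityMeasure (S.empiricalBootLaw n (B n) w) := fun _ =>
    isProbabilityMeasure_empirical hB _
  have hint : Integrable (fun w : (ℕ → X) × (Fin (B n) → Fin M → ℝ) =>
      hybrid (S.sigmaHat n (sampleUpTo n w.1)) (√(n : ℝ) • S.dHat n (sampleUpTo n w.1))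
        (S.empiricalBootLaw n (B n) w).real γ α)
      ((P : Measure (ℕ → X)) ⊗ₘ S.replicates n (B n)) := by
    have := fun w => hybrid_eq_indicator_rejectionEvent (S.empiricalBootLaw n (B n))
      (fun w => S.sigmaHat n (sampleUpTo n w.1))
      (fun w => √(n : ℝ) • S.dHat n (sampleUpTo n w.1)) γ α w
    simp only [this]
    exact (integrable_const 1).indicator (measurableSet_rejectionEvent hα hγ
      (S.measurable_empiricalBootLaw n (B n))
      ((measurable_sigmaHat_sample n).comp measurable_fst)
      ((measurable_dHat_sample n).comp measurable_fst))
  rw [Measure.integral_compProd hint]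
  refine integral_congr_ae (ae_of_all _ fun ω => ?_)
  refine integral_congr_ae (ae_of_all _ fun v => ?_)
  exact hybrid_congr (fun A hA => (empirical_real _ hA).symm) _ _

variable {S} {P : ProbabilityMeasure (ℕ → X)} {V : Matrix (Fin M) (Fin M) ℝ}
  (hP : S.Assumptions P V)

include hP in
/-- The limit of the rejection probability with the simulated bootstrap law. -/
lemma Assumptions.tendsto_rejectionProb_hybridMC (hM : 2 ≤ M) (hdiag : V.IsDiag) {γ α : ℝ}
    (hα : α ∈ Set.Ioo (0 : ℝ) 1) (hγ : γ ∈ Set.Ioo (0 : ℝ) 1) {c : ℝ}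
    (hc : (stdNormal M).real {y | statS 1 y ≤ c} = 1 - α * γ)
    (hcα : α < (gaussianReal 0 1).real (Set.Ioi c)) {G : ℝ → ℝ} (hG : Continuous G)
    (hT : ∀ c, Tendsto (fun n : ℕ => (P : Measure (ℕ → X)).real {ω | c <
      statS (S.sigmaHat n (sampleUpTo n ω)) (√(n : ℝ) • S.dHat n (sampleUpTo n ω))}) atTop
      (𝓝 (G c)))
    (hST : ∀ c, ∀ᶠ x : (Σ _ : ℕ, ℕ → X) in inProb fun _ => (P : Measure (ℕ → X)),
      statS (S.sigmaHat x.1 (sampleUpTo x.1 x.2))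
        (√(x.1 : ℝ) • S.dHat x.1 (sampleUpTo x.1 x.2)) =
      statR (S.sigmaHat x.1 (sampleUpTo x.1 x.2))
        (√(x.1 : ℝ) • S.dHat x.1 (sampleUpTo x.1 x.2)) ∨
      c < statS (S.sigmaHat x.1 (sampleUpTo x.1 x.2))
        (√(x.1 : ℝ) • S.dHat x.1 (sampleUpTo x.1 x.2)))
    {B : ℕ → ℕ} (hB : Tendsto B atTop atTop) :
    Tendsto (rejectionProb (S.hybridMC B γ α) P) atTop (𝓝 (G c)) := by
  -- With no replicates the empirical measure is not a probability measure. As `B n → ∞`, this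
  -- affects finitely many `n` only.
  wlog hB0 : ∀ n, B n ≠ 0 generalizing B
  · have h := this (B := fun n => max (B n) 1)
      (tendsto_atTop_mono (fun n => le_max_left _ _) hB) fun n => by positivity
    refine h.congr' ?_
    filter_upwards [hB.eventually_ge_atTop 1] with n hn
    have hmax : max (B n) 1 = B n := max_eq_left hn
    change rejectionProb (S.hybridMC (fun _ => max (B n) 1) γ α) P n =
      rejectionProb (S.hybridMC (fun _ => B n) γ α) P n
    rw [hmax]
  have : NeZero M := ⟨by omega⟩
  have hprob : ∀ n w, IsProbabilityMeasure (S.empiricalBootLaw n (B n) w) := fun n _ =>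
    isProbabilityMeasure_empirical (hB0 n) _
  have hσ := fun n : ℕ => (measurable_sigmaHat_sample (S := S) n).comp
    (measurable_fst : Measurable (Prod.fst : (ℕ → X) × (Fin M → ℝ) → _))
  have h := tendsto_integral_hybrid
    (ρ := fun n => (P : Measure (ℕ → X)) ⊗ₘ S.replicates n (B n))
    (K := fun n => S.empiricalBootLaw n (B n))
    (s := fun n w => S.sigmaHat n (sampleUpTo n w.1))
    (t := fun n w => √(n : ℝ) • S.dHat n (sampleUpTo n w.1)) hM hα hγ
    (fun n => S.measurable_empiricalBootLaw n (B n))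
    (fun n => (measurable_sigmaHat_sample n).comp measurable_fst)
    (fun n => (measurable_dHat_sample n).comp measurable_fst) hc hcα
    (fun c => S.tendsto_empiricalBootLaw P hB hB0
      (A := fun n ω => {y | statS (S.sigmaHat n (sampleUpTo n ω)) y ≤ c})
      (fun n => measurableSet_le (measurable_statS.comp ((hσ n).prodMk measurable_snd))
        measurable_const) (hP.tendsto_bootLaw_statS hdiag c))
    (fun c => S.tendsto_empiricalBootLaw P hB hB0
      (A := fun n ω => {y | statR (S.sigmaHat n (sampleUpTo n ω)) y ≤ c})
      (fun n => measurableSet_le (measurable_statR.comp ((hσ n).prodMk measurable_snd))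
        measurable_const) (hP.tendsto_bootLaw_statR hdiag c))
    (fun c => (S.tendsto_fst_compProd P B).eventually (hST c)) hG (fun c => ?_)
  · exact h.congr fun n => (S.rejectionProb_hybridMC P hα hγ B n (hB0 n)).symm
  · refine (hT c).congr fun n => ?_
    have hfst : ((P : Measure (ℕ → X)) ⊗ₘ S.replicates n (B n)).map Prod.fst = P :=
      Measure.fst_compProd _ _
    conv_lhs => rw [← hfst]
    rw [map_measureReal_apply measurable_fst
      (measurableSet_lt measurable_const (measurable_statS_sample n))]
    rfl

end ForecastComparison

lemma not_pointwiseAsymptoticLevel_of_tendsto {X : Type*} [MeasurableSpace X]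
    {φ : (n : ℕ) → (Fin n → X) → ℝ} {P₀ : Set (ProbabilityMeasure (ℕ → X))}
    {P : ProbabilityMeasure (ℕ → X)} (hP : P ∈ P₀) {α L : ℝ} (hL : α < L)
    (h : Tendsto (rejectionProb φ P) atTop (𝓝 L)) : ¬ PointwiseAsymptoticLevel φ P₀ α :=
  fun hlevel => (hlevel P hP).not_gt (h.limsup_eq ▸ hL)

end

theorem theorem1 {M : ℕ} (hM : 2 ≤ M) {X Y : Type*} [MeasurableSpace X]
    (S : ForecastComparison M X Y) (P : ProbabilityMeasure (ℕ → X))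
    (V : Matrix (Fin M) (Fin M) ℝ) (hP : S.Assumptions P V)
    (h_zero : ∃ m, S.riskDiff P m = 0) (h_neg : ∃ m, S.riskDiff P m < 0) (h_diag : V.IsDiag)
    (γ : ℝ) (hγ : γ ∈ Set.Ioo (0 : ℝ) 1) :
    ∃ αbar ∈ Set.Ioc (0 : ℝ) (1 / 2), ∀ α ∈ Set.Ioo (0 : ℝ) αbar,
      ((∃ L, α < L ∧ Tendsto (rejectionProb (S.hybridExact γ α) P) atTop (𝓝 L)) ∧
        (S.riskDiff P ≤ 0 →
          ¬ PointwiseAsymptoticLevel (S.hybridExact γ α) S.nullLaws α)) ∧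
      ∀ B : ℕ → ℕ, Tendsto B atTop atTop →
        (∃ L, α < L ∧ Tendsto (rejectionProb (S.hybridMC B γ α) P) atTop (𝓝 L)) ∧
        (S.riskDiff P ≤ 0 →
          ¬ PointwiseAsymptoticLevel (S.hybridMC B γ α) S.nullLaws α) := by
  obtain ⟨αbar, hαbar, hcrit⟩ := exists_critical_value hM hγ
  obtain ⟨G, hG, hGge, hT, hST⟩ := hP.exists_tail_limit h_diag h_zero h_neg
  -- `αbar` comes from `M` and `γ` alone, and the limit `G c` is the same for both kinds of
  -- bootstrap distribution and every `B`.
  refine ⟨αbar, hαbar, fun α hα => ?_⟩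
  obtain ⟨c, hc, hcα⟩ := hcrit α hα
  have hα1 : α ∈ Set.Ioo (0 : ℝ) 1 := ⟨hα.1, by linarith [hα.2, hαbar.2]⟩
  have hnull (hd : S.riskDiff P ≤ 0) : P ∈ S.nullLaws := ⟨hd, V, hP⟩
  have hL : α < G c := hcα.trans_le (hGge c)
  have hexact := hP.tendsto_rejectionProb_hybridExact hM h_diag hα1 hγ hc hcα hG hT hST
  refine ⟨⟨⟨G c, hL, hexact⟩, fun hd =>
    not_pointwiseAsymptoticLevel_of_tendsto (hnull hd) hL hexact⟩, fun B hB => ?_⟩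
  have hMC := hP.tendsto_rejectionProb_hybridMC hM h_diag hα1 hγ hc hcα hG hT hST hB
  exact ⟨⟨G c, hL, hMC⟩, fun hd =>
    not_pointwiseAsymptoticLevel_of_tendsto (hnull hd) hL hMC⟩
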